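/- Let $J,G:\mathbb R^m\times\mathbb R^n\to\mathbb R$ be $C^2$ and, for $\sigma\ge 0$, let $h_\sigma=J-\sigma G$. Consider the bilevel problem $\min_\phi\Phi(\phi)$, where $\Phi(\phi)=\min\{G(\phi,\lambda):\lambda\in\arg\min_{\lambda}-J(\phi,\lambda)\}$, and its proxy $\Phi_\sigma(\phi)=\min_\lambda\big(G(\phi,\lambda)+\tfrac1\sigma(\max_{\lambda'}J(\phi,\lambda')-J(\phi,\lambda))\big)$, $\sigma>0$. Assume that for some $\sigma_0,\mu>0$: (i) for all $0\le\sigma\le\sigma_0$ and all $\phi$, $h_\sigma(\phi,\cdot)$ has a maximizer $\lambda_\sigma^*(\phi)$ and satisfies the Polyak–Łojasiewicz inequality $\mu\,\big(h_\sigma(\phi,\lambda_\sigma^*(\phi))-h_\sigma(\phi,\lambda)\big)\le\|\nabla_\lambda h_\sigma(\phi,\lambda)\|^2$ for all $\lambda$; (ii) $\nabla J$ is $L_J$-Lipschitz, and for all $0\le\sigma\le\sigma_0$, $\nabla h_\sigma$ is $L_h$-Lipschitz and $\nabla^2h_\sigma$ is Lipschitz with a constant independent of $\sigma$; $G$ is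 Lipschitz; (iii) $\Phi$ is bounded below; (iv) one can draw independent samples $\xi$ giving estimates $\nabla\hat J(\phi,\lambda;\xi)$ and $\nabla\hat G(\phi,\lambda;\xi)$ that at every fixed point are unbiased for $\nabla J(\phi,\lambda)$ and $\nabla G(\phi,\lambda)$, with variances at most $\sigma_J^2$ and $\sigma_G^2$. Write $\nabla J(\cdot,B)$, $\nabla G(\cdot,B)$ for averages of $B$ fresh estimates. Algorithm: given $\phi_0,\lambda_0^0,{\lambda'}_0^0$, for $t=0,\dots,T-1$ run, for $k=0,\dots,K-1$, $$\lambda_t^{k+1}=\lambda_t^k+\tau_k\nabla_\lambda J(\phi_t,\lambda_t^k,B),\qquad {\lambda'}_t^{k+1}={\lambda'}_t^k+\tau'_k\big(\nabla_\lambda J(\phi_t,{\lambda'}_t^k,B)-\sigma\nabla_\lambda G(\phi_t,{\lambda'}_t^k,B)\big),$$ then $$\phi_{t+1}=\phi_t-\eta\Big(\nabla_\phi G(\phi_t,{\lambda'}_t^K,B)+\tfrac1\sigma\big(\nabla_\phi J(\phi_t,\lambda_t^K,B)-\nabla_\phi J(\phi_t,{\lambda'}_t^K,B)\big)\Big),$$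 and $\lambda_{t+1}^0=\lambda_t^K$, ${\lambda'}_{t+1}^0={\lambda'}_t^K$. Then $\Phi$ is differentiable, and there is an $L$ such that every $\Phi_\sigma$ with $0<\sigma\le\sigma_0$ is differentiable with $L$-Lipschitz gradient. For every such $L$, every $0<\eta\le\frac1{2L}$ and every $\tau_{\min}>0$ there are constants $C,c,a>0$ such that, for all step sizes $\tau_k\in[\tau_{\min},1/L_J]$, $\tau'_k\in[\tau_{\min},1/L_h]$ and all gradient estimates as in (iv): 1. for all $0<\sigma\le\sigma_0$, $T,B\ge1$ and $K\ge0$, $$\frac1T\sum_{t=1}^T\mathbb E\|\nabla\Phi(\phi_t)\|^2\le C\Big(\frac1T+\frac{e^{-cK}}{\sigma^2}+\frac1{\sigma^2B}+\sigma^2\Big);$$ 2. for all $0<\varepsilon\le\min(1,\sigma_0^2)$, with $\sigma^2=\varepsilon$, $B=\lceil\varepsilon^{-2}\rceil$, $T=\lceil\varepsilon^{-1}\rceil$ and $K=\lceil a\log(1/\varepsilon)\rceil$, $$\frac1T\sum_{t=1}^T\mathbb E\|\nabla\Phi(\phi_t)\|^2\le C\varepsilon,$$ and the number $3(BKT+BT)$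 of samples drawn is at most $C\varepsilon^{-3}(1+\log(1/\varepsilon))=\tilde{\mathcal O}(\varepsilon^{-3})$. The constants $C,c,a$ do not depend on $\sigma,T,K,B,\varepsilon$, on the chosen step-size sequences, or on the law of the estimates beyond $\sigma_J,\sigma_G$. -/

import Mathlib

open MeasureTheory ProbabilityTheory
open scoped NNReal

universe u v

noncomputable section

namespace Bilevel

/-- The joint space `ℝ^(m+n)` of an upper-level variable in `ℝ^m` and a lower-level variable in
`ℝ^n`, with the Euclidean norm. -/
abbrev Joint (m n : ℕ) : Type := EuclideanSpace ℝ (Fin m ⊕ Fin n)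

/-- The joint point `(φ, y)`. -/
def pt {m n : ℕ} (φ : EuclideanSpace ℝ (Fin m)) (y : EuclideanSpace ℝ (Fin n)) : Joint m n :=
  WithLp.toLp 2 (Sum.elim (fun i => φ i) (fun j => y j))

/-- The upper-level block of a joint vector; applied to a gradient, it gives `∇_φ`. -/
def upper {m n : ℕ} (z : Joint m n) : EuclideanSpace ℝ (Fin m) :=
  WithLp.toLp 2 (fun i => z (Sum.inl i))

/-- The lower-level block of a joint vector; applied to a gradient, it gives the gradient in the
lower-level variable. -/
def lower {m n : ℕ} (z : Joint m n) : EuclideanSpace ℝ (Fin n) :=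
  WithLp.toLp 2 (fun j => z (Sum.inr j))

/-- The penalty function `h_σ = J - σ G`. -/
def penalty {m n : ℕ} (J G : Joint m n → ℝ) (σ : ℝ) : Joint m n → ℝ :=
  fun z => J z - σ * G z

/-- The set of solutions of the lower-level problem `min_y -J(φ, y)`. -/
def lowerSolutions {m n : ℕ} (J : Joint m n → ℝ) (φ : EuclideanSpace ℝ (Fin m)) :
    Set (EuclideanSpace ℝ (Fin n)) :=
  {y | ∀ y', J (pt φ y') ≤ J (pt φ y)}

/-- The hyper-objective `Φ(φ) = min {G(φ, y) | y solves the lower-level problem at φ}`. -/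
def hyperObjective {m n : ℕ} (J G : Joint m n → ℝ) (φ : EuclideanSpace ℝ (Fin m)) : ℝ :=
  sInf ((fun y => G (pt φ y)) '' lowerSolutions J φ)

/-- The proxy objective `Φ_σ(φ) = min_y (G(φ, y) + (max_{y'} J(φ, y') - J(φ, y)) / σ)`. -/
def proxyObjective {m n : ℕ} (J G : Joint m n → ℝ) (σ : ℝ) (φ : EuclideanSpace ℝ (Fin m)) : ℝ :=
  ⨅ y, (G (pt φ y) + ((⨆ y', J (pt φ y')) - J (pt φ y)) / σ)

/-- Every proxy objective `Φ_σ` with `0 < σ ≤ σ₀` is differentiable and `L`-smooth. -/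
def ProxySmooth {m n : ℕ} (J G : Joint m n → ℝ) (σ₀ : ℝ) (L : ℝ≥0) : Prop :=
  ∀ σ : ℝ, 0 < σ → σ ≤ σ₀ →
    Differentiable ℝ (proxyObjective J G σ) ∧
      LipschitzWith L (fun φ => gradient (proxyObjective J G σ) φ)

/-- Regularity of the bilevel problem: the Polyak-Łojasiewicz inequality in the lower-level
variable for all `h_σ = J - σ G` with `0 ≤ σ ≤ σ₀` (lower-level maximisation of `h_σ`), smoothness
of `J` and of the `h_σ`, Lipschitz Hessians, and a Lipschitz upper-level objective. -/
structure Regular {m n : ℕ} (J G : Joint m n → ℝ) (σ₀ μ : ℝ) (LJ Lh LH LG : ℝ≥0) : Prop where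
  sigma_pos : 0 < σ₀
  mu_pos : 0 < μ
  /-- For `0 ≤ σ ≤ σ₀`, `h_σ(φ, ·)` has a maximiser and satisfies the PL inequality. -/
  pl : ∀ σ : ℝ, 0 ≤ σ → σ ≤ σ₀ → ∀ φ : EuclideanSpace ℝ (Fin m),
    ∃ ystar : EuclideanSpace ℝ (Fin n),
      (∀ y, penalty J G σ (pt φ y) ≤ penalty J G σ (pt φ ystar)) ∧
      ∀ y, μ * (penalty J G σ (pt φ ystar) - penalty J G σ (pt φ y)) ≤
        ‖lower (gradient (penalty J G σ) (pt φ y))‖ ^ 2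
  contDiff_J : ContDiff ℝ 2 J
  contDiff_G : ContDiff ℝ 2 G
  smooth_J : LipschitzWith LJ (fun z => gradient J z)
  smooth_h : ∀ σ : ℝ, 0 ≤ σ → σ ≤ σ₀ → LipschitzWith Lh (fun z => gradient (penalty J G σ) z)
  hessian_h : ∀ σ : ℝ, 0 ≤ σ → σ ≤ σ₀ →
    LipschitzWith LH (fun z => fderiv ℝ (fun w => gradient (penalty J G σ) w) z)
  lipschitz_G : LipschitzWith LG G

/-- `g z ξ`, with `ξ` of law `D`, is an unbiased estimate of the gradient of `f` at `z`
with variance at most `s²`, for every fixed `z`. -/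
structure IsStochGradient {m n : ℕ} {Ξ : Type*} [MeasurableSpace Ξ] (D : Measure Ξ)
    (f : Joint m n → ℝ) (g : Joint m n → Ξ → Joint m n) (s : ℝ) : Prop where
  measurable : Measurable (fun p : Joint m n × Ξ => g p.1 p.2)
  integrable : ∀ z, Integrable (g z) D
  unbiased : ∀ z, ∫ ξ, g z ξ ∂D = gradient f z
  integrable_sq : ∀ z, Integrable (fun ξ => ‖g z ξ - gradient f z‖ ^ 2) D
  variance_le : ∀ z, ∫ ξ, ‖g z ξ - gradient f z‖ ^ 2 ∂D ≤ s ^ 2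

/-- Labels of the random samples. The label `(t, k, i, j)` is sample `j` of the minibatch used in
outer iteration `t`, at inner iteration `k` (`k = K` being the update of `φ` after the `K` inner
iterations), for the estimate number `i`:
`0` for the gradient of `J` at `(φ, y)`, `1` for the gradient of `J` at `(φ, y')`,
`2` for the gradient of `G` at `(φ, y')`. -/
abbrev Label : Type := ℕ × ℕ × Fin 3 × ℕ

/-- The labels of the samples drawn in `T` outer iterations with `K` inner iterations each and
minibatches of size `B`. -/
def drawnSamples (T K B : ℕ) : Finset Label :=
  Finset.range T ×ˢ Finset.range (K + 1) ×ˢ (Finset.univ : Finset (Fin 3)) ×ˢ Finset.range B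

theorem card_drawnSamples (T K B : ℕ) :
    (drawnSamples T K B).card = 3 * (B * K * T + B * T) := by
  simp only [drawnSamples, Finset.card_product, Finset.card_range, Finset.card_univ,
    Fintype.card_fin]
  ring

/-- Stochastic first-order access to `J` and `G`: unbiased gradient estimates with variances at
most `sJ²` and `sG²`, and an independent family of samples on some probability space. -/
structure SamplingModel {m n : ℕ} (J G : Joint m n → ℝ) (sJ sG : ℝ) where
  Ξ : Type u
  [mΞ : MeasurableSpace Ξ]
  /-- the law of one sample -/
  D : Measure Ξ
  [probD : IsProbabilityMeasure D]
  gJ : Joint m n → Ξ → Joint m n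
  gG : Joint m n → Ξ → Joint m n
  stochGradient_J : IsStochGradient D J gJ sJ
  stochGradient_G : IsStochGradient D G gG sG
  Ω : Type v
  [mΩ : MeasurableSpace Ω]
  P : Measure Ω
  [probP : IsProbabilityMeasure P]
  sample : Label → Ω → Ξ
  measurable_sample : ∀ l, Measurable (sample l)
  law_sample : ∀ l, P.map (sample l) = D
  indep_sample : iIndepFun sample P

attribute [instance] SamplingModel.mΞ SamplingModel.probD SamplingModel.mΩ SamplingModel.probP

/-- The minibatch average of `B` gradient estimates at `z`. -/
def minibatch {m n : ℕ} {Ξ : Type*} (g : Joint m n → Ξ → Joint m n) (B : ℕ) (z : Joint m n)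
    (x : ℕ → Ξ) : Joint m n :=
  (1 / (B : ℝ)) • ∑ j ∈ Finset.range B, g z (x j)

/-- Inner loop: stochastic gradient ascent on `J(φ, ·)` from `y₀` with step sizes `τ k`. -/
def innerJ {m n : ℕ} {Ξ : Type*} (gJ : Joint m n → Ξ → Joint m n) (B : ℕ) (τ : ℕ → ℝ)
    (φ : EuclideanSpace ℝ (Fin m)) (y₀ : EuclideanSpace ℝ (Fin n)) (x : ℕ → Fin 3 → ℕ → Ξ) :
    ℕ → EuclideanSpace ℝ (Fin n)
  | 0 => y₀
  | k + 1 =>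
    innerJ gJ B τ φ y₀ x k +
      τ k • lower (minibatch gJ B (pt φ (innerJ gJ B τ φ y₀ x k)) (x k 0))

/-- Inner loop: stochastic gradient ascent on `h_σ(φ, ·) = J(φ, ·) - σ G(φ, ·)` from `y₀` with
step sizes `τ k`. -/
def innerPenalty {m n : ℕ} {Ξ : Type*} (gJ gG : Joint m n → Ξ → Joint m n) (B : ℕ) (σ : ℝ)
    (τ : ℕ → ℝ) (φ : EuclideanSpace ℝ (Fin m)) (y₀ : EuclideanSpace ℝ (Fin n))
    (x : ℕ → Fin 3 → ℕ → Ξ) : ℕ → EuclideanSpace ℝ (Fin n)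
  | 0 => y₀
  | k + 1 =>
    innerPenalty gJ gG B σ τ φ y₀ x k +
      τ k • (lower (minibatch gJ B (pt φ (innerPenalty gJ gG B σ τ φ y₀ x k)) (x k 1)) -
        σ • lower (minibatch gG B (pt φ (innerPenalty gJ gG B σ τ φ y₀ x k)) (x k 2)))

/-- The estimate `∇_φ Ĝ(φ, y') + (∇_φ Ĵ(φ, y) - ∇_φ Ĵ(φ, y')) / σ` of the gradient of `Φ_σ`. -/
def hyperEstimate {m n : ℕ} {Ξ : Type*} (gJ gG : Joint m n → Ξ → Joint m n) (B : ℕ) (σ : ℝ)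
    (φ : EuclideanSpace ℝ (Fin m)) (y y' : EuclideanSpace ℝ (Fin n)) (x : Fin 3 → ℕ → Ξ) :
    EuclideanSpace ℝ (Fin m) :=
  upper (minibatch gG B (pt φ y') (x 2)) +
    (1 / σ) • (upper (minibatch gJ B (pt φ y) (x 0)) - upper (minibatch gJ B (pt φ y') (x 1)))

/-- The state of the algorithm at the start of an outer iteration: the upper-level iterate and the
two lower-level iterates. -/
structure State (m n : ℕ) where
  φ : EuclideanSpace ℝ (Fin m)
  y : EuclideanSpace ℝ (Fin n)
  y' : EuclideanSpace ℝ (Fin n)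

/-- The first-order bilevel algorithm run on a fixed realisation `x` of all samples, from the state
`s₀`: `state … t` is the state after `t` outer iterations. The inner loops of an outer iteration
start at the last inner iterates of the previous one. -/
def state {m n : ℕ} {Ξ : Type*} (gJ gG : Joint m n → Ξ → Joint m n) (K B : ℕ) (σ η : ℝ)
    (τ τ' : ℕ → ℝ) (s₀ : State m n) (x : Label → Ξ) : ℕ → State m n
  | 0 => s₀
  | t + 1 =>
    let s := state gJ gG K B σ η τ τ' s₀ x t
    let xt : ℕ → Fin 3 → ℕ → Ξ := fun k i j => x (t, k, i, j)
    let yK := innerJ gJ B τ s.φ s.y xt K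
    let yK' := innerPenalty gJ gG B σ τ' s.φ s.y' xt K
    { φ := s.φ - η • hyperEstimate gJ gG B σ s.φ yK yK' (xt K)
      y := yK
      y' := yK' }

/-- The random upper-level iterate `φ_t` of the algorithm. -/
def SamplingModel.iterate {m n : ℕ} {J G : Joint m n → ℝ} {sJ sG : ℝ}
    (S : SamplingModel J G sJ sG) (K B : ℕ) (σ η : ℝ) (τ τ' : ℕ → ℝ) (s₀ : State m n) (t : ℕ)
    (ω : S.Ω) : EuclideanSpace ℝ (Fin m) :=
  (state S.gJ S.gG K B σ η τ τ' s₀ (fun l => S.sample l ω) t).φ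

/-- The average expected squared hypergradient norm `(1/T) ∑_{t=1}^T E ‖∇Φ(φ_t)‖²`. -/
def SamplingModel.avgSqGrad {m n : ℕ} {J G : Joint m n → ℝ} {sJ sG : ℝ}
    (S : SamplingModel J G sJ sG) (T K B : ℕ) (σ η : ℝ) (τ τ' : ℕ → ℝ) (s₀ : State m n) : ℝ :=
  (1 / (T : ℝ)) * ∑ t ∈ Finset.Icc 1 T,
    ∫ ω, ‖gradient (hyperObjective J G) (S.iterate K B σ η τ τ' s₀ t ω)‖ ^ 2 ∂S.P

end Bilevel

end

noncomputable section

namespace Bilevel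

/-! ### Calculus: second differences, the descent lemma, gradients from quadratic bounds -/

section Calculus

/-! The algorithm is inexact gradient descent on the proxy `Φ_σ`. Two things make this work
uniformly in `σ`: `Φ_σ` stays smooth and its gradient stays within `O(σ)` of `∇Φ`, although its
formula contains `1/σ`; and the lower-level errors, amplified by `1/σ²`, do not accumulate over the
outer iterations.

Deterministic part. Under the PL inequality gradient ascent has a trajectory of geometrically
summable length, so a point lies within a multiple of its lower-level gradient norm from a maximiser
(`PLSmooth.exists_near`). Hence solution sets move in a Lipschitz way, and Danskin's theorem holds
with any maximiser, even a non-unique one (`PLSmooth.hasGradientAt_maxVal`). Since `Φ_σ = (max J -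
max h_σ)/σ`, this gives `∇Φ_σ` explicitly. The factor `1/σ` is cancelled by a parallelogram: one
corner is a maximiser `z` of `J`, one side `a = O(σ)` leads to a maximiser of `h_σ`, the other side
`b` to a maximiser of `J` at `φ'`. A second difference of gradients is `O(‖a‖‖b‖)`, because Hessians
are Lipschitz, and the known corners have zero lower-level gradient. So the fourth corner is almost
critical for `h_σ`, and its upper gradient is almost that of a true maximiser. The same argument
with `b = a` compares `σ` and `2σ`. Along `σ/2^k` the proxy gradients are therefore Cauchy; their
limit is `∇Φ`, because the descent-lemma inequalities for `Φ_σ` pass to the limit.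

Stochastic part. Each minibatch is independent of the point where it is evaluated, so its mean
squared error is `O(1/B)`. The inner loops multiply the gap by `ρ^K` up to this error, while a move
of `φ` between two loops costs a constant factor plus `O(‖φ_{t+1} - φ_t‖²)`. If `ρ^K` is at most a
small multiple of `σ²`, an induction bounds all gaps by `O(ρ^K + 1/B)` (`InexactRun.meanLE_gaps`),
and telescoping the descent inequality for `Φ_σ` gives the rate. Otherwise `ρ^K/σ²` is bounded
below, and boundedness of `∇Φ` suffices. -/

theorem norm_second_difference_le {E F : Type*}
    [NormedAddCommGroup E] [NormedSpace ℝ E] [NormedAddCommGroup F] [NormedSpace ℝ F]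
    {f : E → F} {L : ℝ≥0} (hd : Differentiable ℝ f)
    (hL : LipschitzWith L (fun x => fderiv ℝ f x)) (z a b : E) :
    ‖f (z + a + b) - f (z + a) - f (z + b) + f z‖ ≤ L * ‖a‖ * ‖b‖ := by
  have hda : Differentiable ℝ fun x => f (x + a) := hd.comp (differentiable_id.add_const a)
  -- Mean value inequality for the increment `x ↦ f (x + a) - f x`, whose derivative is bounded by
  -- `L ‖a‖`.
  have key := (convex_univ (𝕜 := ℝ) (E := E)).norm_image_sub_le_of_norm_fderiv_le (𝕜 := ℝ)
    (f := fun x => f (x + a) - f x) (C := L * ‖a‖) (x := z) (y := z + b)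
    (fun x _ => (hda x).sub (hd x))
    (fun x _ => by
      rw [fderiv_fun_sub (hda x) (hd x), fderiv_comp_add_right]
      simpa [dist_eq_norm] using hL.dist_le_mul (x + a) x)
    (Set.mem_univ _) (Set.mem_univ _)
  rw [add_sub_cancel_left] at key
  convert key using 2
  rw [add_right_comm z a b]
  abel

variable {E : Type*} [NormedAddCommGroup E] [InnerProductSpace ℝ E] [CompleteSpace E]

/-- The descent lemma: a function with `L`-Lipschitz gradient is within `L/2 ‖d‖²` of its
first-order expansion. -/
theorem abs_sub_inner_gradient_le {f : E → ℝ} {L : ℝ≥0} (hd : Differentiable ℝ f)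
    (hL : LipschitzWith L (fun x => gradient f x)) (x d : E) :
    |f (x + d) - f x - inner ℝ (gradient f x) d| ≤ L / 2 * ‖d‖ ^ 2 := by
  have hline : ∀ t : ℝ, HasDerivAt (fun t : ℝ => x + t • d) d t := fun t => by
    simpa using ((hasDerivAt_id t).smul_const d).const_add x
  have hder : ∀ t : ℝ, HasDerivAt
      (fun t : ℝ => f (x + t • d) - f x - t * inner ℝ (gradient f x) d)
      (inner ℝ (gradient f (x + t • d)) d - inner ℝ (gradient f x) d) t := fun t => by
    have h1 := (hd (x + t • d)).hasFDerivAt.comp_hasDerivAt t (hline t)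
    rw [← inner_gradient_left] at h1
    have h2 : HasDerivAt (fun t : ℝ => t * inner ℝ (gradient f x) d) (inner ℝ (gradient f x) d) t := by
      simpa only [id, one_mul] using (hasDerivAt_id t).mul_const (inner ℝ (gradient f x) d)
    exact (h1.sub_const (f x)).sub h2
  have hB : ∀ t : ℝ, HasDerivAt (fun t : ℝ => L / 2 * ‖d‖ ^ 2 * t ^ 2) (L * ‖d‖ ^ 2 * t) t :=
    fun t => ((hasDerivAt_pow 2 t).const_mul (L / 2 * ‖d‖ ^ 2 : ℝ)).congr_deriv (by
      push_cast; ring)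
  have key := image_norm_le_of_norm_deriv_right_le_deriv_boundary (a := (0 : ℝ)) (b := 1)
    (f := fun t : ℝ => f (x + t • d) - f x - t * inner ℝ (gradient f x) d)
    (fun t _ => (hder t).continuousAt.continuousWithinAt)
    (fun t _ => (hder t).hasDerivWithinAt) (by simp) hB
    (fun t ht => by
      rw [← inner_sub_left]
      calc ‖inner ℝ (gradient f (x + t • d) - gradient f x) d‖
          ≤ ‖gradient f (x + t • d) - gradient f x‖ * ‖d‖ := norm_inner_le_norm _ _
        _ ≤ L * ‖t • d‖ * ‖d‖ := by
          gcongr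
          simpa [dist_eq_norm] using hL.dist_le_mul (x + t • d) x
        _ = L * ‖d‖ ^ 2 * t := by
          rw [norm_smul, Real.norm_of_nonneg ht.1]; ring)
    (Set.right_mem_Icc.2 zero_le_one)
  simpa using key

/-- A quadratic remainder is `o(‖d‖)`. This is how differentiability is obtained both for value
functions and for pointwise limits of uniformly smooth functions. -/
theorem hasGradientAt_of_quadratic_bound {f : E → ℝ} {x g : E} {C : ℝ}
    (h : ∀ d, |f (x + d) - f x - inner ℝ g d| ≤ C * ‖d‖ ^ 2) : HasGradientAt f g x := by
  rw [hasGradientAt_iff_isLittleO_nhds_zero]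
  have hO : (fun d => f (x + d) - f x - inner ℝ g d) =O[nhds 0] fun d : E => ‖d‖ ^ 2 :=
    Asymptotics.IsBigO.of_bound C (Filter.Eventually.of_forall fun d => by
      simpa using h d)
  refine hO.trans_isLittleO ?_
  have := Asymptotics.isLittleO_norm_pow_id (E' := E) one_lt_two
  simpa using this

theorem norm_gradient_le_of_lipschitzWith {f : E → ℝ} {L : ℝ≥0} (hL : LipschitzWith L f) (x : E) :
    ‖gradient f x‖ ≤ L := by
  rw [gradient, LinearIsometryEquiv.norm_map]
  exact norm_fderiv_le_of_lipschitz ℝ hL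

theorem differentiable_gradient {f : E → ℝ} (hf : ContDiff ℝ 2 f) :
    Differentiable ℝ (fun x => gradient f x) :=
  (InnerProductSpace.toDual ℝ E).symm.toContinuousLinearEquiv.differentiable.comp
    ((hf.fderiv_right (m := 1) (by norm_num)).differentiable (by norm_num))

theorem measurable_gradient [MeasurableSpace E] [BorelSpace E] (f : E → ℝ) :
    Measurable (fun x => gradient f x) :=
  (InnerProductSpace.toDual ℝ E).symm.continuous.measurable.comp (measurable_fderiv ℝ f)

end Calculus

/-! ### The joint Euclidean space and its two blocks -/

section JointSpace

variable {m n : ℕ}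

theorem pt_add (φ φ' : EuclideanSpace ℝ (Fin m)) (y y' : EuclideanSpace ℝ (Fin n)) :
    pt (φ + φ') (y + y') = pt φ y + pt φ' y' := by
  ext i; cases i <;> rfl

theorem pt_sub (φ φ' : EuclideanSpace ℝ (Fin m)) (y y' : EuclideanSpace ℝ (Fin n)) :
    pt (φ - φ') (y - y') = pt φ y - pt φ' y' := by
  ext i; cases i <;> rfl

theorem upper_add (z w : Joint m n) : upper (z + w) = upper z + upper w := rfl
theorem lower_add (z w : Joint m n) : lower (z + w) = lower z + lower w := rfl
theorem upper_sub (z w : Joint m n) : upper (z - w) = upper z - upper w := rfl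
theorem lower_sub (z w : Joint m n) : lower (z - w) = lower z - lower w := rfl
theorem upper_smul (c : ℝ) (z : Joint m n) : upper (c • z) = c • upper z := rfl
theorem lower_smul (c : ℝ) (z : Joint m n) : lower (c • z) = c • lower z := rfl

theorem norm_sq_eq_upper_add_lower (z : Joint m n) :
    ‖z‖ ^ 2 = ‖upper z‖ ^ 2 + ‖lower z‖ ^ 2 := by
  simp only [EuclideanSpace.real_norm_sq_eq, Fintype.sum_sum_type]
  rfl

theorem norm_pt_sq (φ : EuclideanSpace ℝ (Fin m)) (y : EuclideanSpace ℝ (Fin n)) :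
    ‖pt φ y‖ ^ 2 = ‖φ‖ ^ 2 + ‖y‖ ^ 2 := norm_sq_eq_upper_add_lower _

theorem norm_upper_le (z : Joint m n) : ‖upper z‖ ≤ ‖z‖ :=
  abs_le_of_sq_le_sq' (by nlinarith [norm_sq_eq_upper_add_lower z, sq_nonneg ‖lower z‖])
    (norm_nonneg z) |>.2

theorem norm_lower_le (z : Joint m n) : ‖lower z‖ ≤ ‖z‖ :=
  abs_le_of_sq_le_sq' (by nlinarith [norm_sq_eq_upper_add_lower z, sq_nonneg ‖upper z‖])
    (norm_nonneg z) |>.2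

theorem norm_pt_le (φ : EuclideanSpace ℝ (Fin m)) (y : EuclideanSpace ℝ (Fin n)) :
    ‖pt φ y‖ ≤ ‖φ‖ + ‖y‖ :=
  abs_le_of_sq_le_sq' (by nlinarith [norm_pt_sq φ y, norm_nonneg φ, norm_nonneg y])
    (by positivity) |>.2

theorem norm_pt_zero_left (y : EuclideanSpace ℝ (Fin n)) :
    ‖pt (0 : EuclideanSpace ℝ (Fin m)) y‖ = ‖y‖ := by
  rw [← sq_eq_sq₀ (norm_nonneg _) (norm_nonneg _), norm_pt_sq]; simp

theorem norm_pt_zero_right (φ : EuclideanSpace ℝ (Fin m)) :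
    ‖pt φ (0 : EuclideanSpace ℝ (Fin n))‖ = ‖φ‖ := by
  rw [← sq_eq_sq₀ (norm_nonneg _) (norm_nonneg _), norm_pt_sq]; simp

theorem inner_pt (z : Joint m n) (φ : EuclideanSpace ℝ (Fin m)) (y : EuclideanSpace ℝ (Fin n)) :
    inner ℝ z (pt φ y) = inner ℝ (upper z) φ + inner ℝ (lower z) y := by
  simp only [PiLp.inner_apply, Fintype.sum_sum_type]
  rfl

theorem measurable_pt :
    Measurable fun p : EuclideanSpace ℝ (Fin m) × EuclideanSpace ℝ (Fin n) => pt p.1 p.2 := by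
  refine (WithLp.measurable_toLp 2 _).comp (measurable_pi_lambda _ fun i => ?_)
  cases i with
  | inl i => exact ((EuclideanSpace.proj (𝕜 := ℝ) i).continuous.measurable).comp measurable_fst
  | inr i => exact ((EuclideanSpace.proj (𝕜 := ℝ) i).continuous.measurable).comp measurable_snd

theorem measurable_upper : Measurable (upper : Joint m n → _) :=
  (WithLp.measurable_toLp 2 _).comp
    (measurable_pi_lambda _ fun i => (EuclideanSpace.proj (𝕜 := ℝ) (Sum.inl i)).continuous.measurable)

theorem measurable_lower : Measurable (lower : Joint m n → _) :=
  (WithLp.measurable_toLp 2 _).comp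
    (measurable_pi_lambda _ fun i => (EuclideanSpace.proj (𝕜 := ℝ) (Sum.inr i)).continuous.measurable)

end JointSpace

/-! ### Consequences of the PL inequality: error bound, Lipschitz solution sets, Danskin's theorem
-/

section PolyakLojasiewicz

variable {m n : ℕ}

/-- `f` has an `L`-Lipschitz gradient and, for each `φ`, the function `f(φ, ·)` has a maximiser and
satisfies the Polyak-Łojasiewicz inequality with constant `μ`. -/
structure PLSmooth (f : Joint m n → ℝ) (L : ℝ≥0) (μ : ℝ) : Prop where
  mu_pos : 0 < μ
  diff : Differentiable ℝ f
  lip : LipschitzWith L (fun z => gradient f z)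
  pl : ∀ φ : EuclideanSpace ℝ (Fin m), ∃ ystar : EuclideanSpace ℝ (Fin n),
    (∀ y, f (pt φ y) ≤ f (pt φ ystar)) ∧
      ∀ y, μ * (f (pt φ ystar) - f (pt φ y)) ≤ ‖lower (gradient f (pt φ y))‖ ^ 2

/-- The value function `φ ↦ max_y f(φ, y)`. -/
def maxVal (f : Joint m n → ℝ) (φ : EuclideanSpace ℝ (Fin m)) : ℝ := ⨆ y, f (pt φ y)

theorem maxVal_eq {f : Joint m n → ℝ} {φ : EuclideanSpace ℝ (Fin m)}
    {y : EuclideanSpace ℝ (Fin n)} (hy : y ∈ lowerSolutions f φ) : maxVal f φ = f (pt φ y) :=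
  le_antisymm (ciSup_le hy) (le_ciSup (f := fun y => f (pt φ y)) ⟨_, Set.forall_mem_range.2 hy⟩ y)

/-- The suboptimality gap `max_{y'} f(φ, y') - f(φ, y)`. -/
def gap (f : Joint m n → ℝ) (φ : EuclideanSpace ℝ (Fin m)) (y : EuclideanSpace ℝ (Fin n)) : ℝ :=
  maxVal f φ - f (pt φ y)

/-- Rate of gradient ascent with step size `1 / (L + μ + 1)`. -/
def ascentRate (L : ℝ≥0) (μ : ℝ) : ℝ := 1 - μ / (2 * (L + μ + 1))

/-- The error-bound constant of an `L`-smooth function satisfying the PL inequality. -/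
def errConst (L : ℝ≥0) (μ : ℝ) : ℝ :=
  Real.sqrt (2 / ((L + μ + 1) * μ)) / (1 - Real.sqrt (ascentRate L μ))

theorem ascentRate_mem {L : ℝ≥0} {μ : ℝ} (hμ : 0 < μ) : 0 < ascentRate L μ ∧ ascentRate L μ < 1 := by
  have hL := L.2
  have hM : (0 : ℝ) < 2 * (L + μ + 1) := by positivity
  have h1 : μ / (2 * (L + μ + 1)) < 1 := by
    rw [div_lt_one hM]; change 0 ≤ (L : ℝ) at hL; linarith
  have h2 : 0 < μ / (2 * (L + μ + 1)) := by positivity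
  unfold ascentRate
  constructor <;> linarith

theorem errConst_nonneg {L : ℝ≥0} {μ : ℝ} (hμ : 0 < μ) : 0 ≤ errConst L μ := by
  have h := ascentRate_mem (L := L) hμ
  have : Real.sqrt (ascentRate L μ) < 1 := by
    rw [Real.sqrt_lt' one_pos]; linarith
  exact div_nonneg (Real.sqrt_nonneg _) (by linarith)

namespace PLSmooth

variable {f : Joint m n → ℝ} {L : ℝ≥0} {μ : ℝ} (hf : PLSmooth f L μ)
include hf

theorem exists_mem (φ : EuclideanSpace ℝ (Fin m)) : ∃ y, y ∈ lowerSolutions f φ :=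
  let ⟨y, hy, _⟩ := hf.pl φ
  ⟨y, hy⟩

theorem le_maxVal (φ : EuclideanSpace ℝ (Fin m)) (y : EuclideanSpace ℝ (Fin n)) :
    f (pt φ y) ≤ maxVal f φ := by
  obtain ⟨y₀, hy₀⟩ := hf.exists_mem φ
  exact (maxVal_eq hy₀).symm ▸ hy₀ y

theorem gap_nonneg (φ : EuclideanSpace ℝ (Fin m)) (y : EuclideanSpace ℝ (Fin n)) :
    0 ≤ gap f φ y := sub_nonneg.2 (hf.le_maxVal φ y)

theorem mul_gap_le (φ : EuclideanSpace ℝ (Fin m)) (y : EuclideanSpace ℝ (Fin n)) :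
    μ * gap f φ y ≤ ‖lower (gradient f (pt φ y))‖ ^ 2 := by
  obtain ⟨y₀, hy₀, h⟩ := hf.pl φ
  rw [gap, maxVal_eq hy₀]
  exact h y

/-- One ascent step in the lower-level variable. -/
theorem le_step (φ : EuclideanSpace ℝ (Fin m)) (y d : EuclideanSpace ℝ (Fin n)) :
    f (pt φ y) + inner ℝ (lower (gradient f (pt φ y))) d - L / 2 * ‖d‖ ^ 2 ≤ f (pt φ (y + d)) := by
  have h := abs_sub_inner_gradient_le hf.diff hf.lip (pt φ y) (pt 0 d)
  rw [← pt_add, add_zero, inner_pt, inner_zero_right, zero_add, norm_pt_zero_left] at h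
  linarith [(abs_le.1 h).1]

/-- Inexact gradient ascent decreases the gap geometrically, up to the error of the gradient. -/
theorem gap_step {τ : ℝ} (hτ : 0 ≤ τ) (hτL : τ * L ≤ 1) (φ : EuclideanSpace ℝ (Fin m))
    (y g : EuclideanSpace ℝ (Fin n)) :
    gap f φ (y + τ • g) ≤
      (1 - τ * μ / 2) * gap f φ y + τ / 2 * ‖g - lower (gradient f (pt φ y))‖ ^ 2 := by
  have h1 := hf.le_step φ y (τ • g)
  have h2 := mul_le_mul_of_nonneg_left (hf.mul_gap_le φ y) hτ
  have h3 := norm_sub_sq_real g (lower (gradient f (pt φ y)))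
  rw [inner_smul_right, norm_smul, Real.norm_of_nonneg hτ, real_inner_comm] at h1
  -- Writing the inner product through `‖g - ∇‖²` leaves `-(τ/2)(1 - τL)‖g‖²`, which is discarded
  -- since `τL ≤ 1`.
  have h4 := mul_nonneg (mul_nonneg hτ (sub_nonneg.2 hτL)) (sq_nonneg ‖g‖)
  have h5 : gap f φ (y + τ • g) = gap f φ y + f (pt φ y) - f (pt φ (y + τ • g)) := by
    unfold gap; ring
  rw [h5, h3]
  nlinarith

/-- An ascent step of size `1/(L+1)` cannot exceed the maximum. Using `L + 1` instead of `L` covers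
`L = 0`. -/
theorem norm_lower_gradient_sq_le (φ : EuclideanSpace ℝ (Fin m)) (y : EuclideanSpace ℝ (Fin n)) :
    ‖lower (gradient f (pt φ y))‖ ^ 2 ≤ 2 * (L + 1) * gap f φ y := by
  set g := lower (gradient f (pt φ y)) with hg
  have hL : (0 : ℝ) ≤ L := L.2
  have h1 := hf.le_step φ y ((1 / (L + 1 : ℝ)) • g)
  have h2 := hf.le_maxVal φ (y + (1 / (L + 1 : ℝ)) • g)
  have hp : (0 : ℝ) ≤ 1 / (L + 1) := by positivity
  rw [← hg, inner_smul_right, real_inner_self_eq_norm_sq, norm_smul, Real.norm_of_nonneg hp] at h1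
  have h3 : ‖g‖ ^ 2 / (2 * (L + 1)) ≤ gap f φ y := by
    have : ‖g‖ ^ 2 / (2 * (L + 1)) + ‖g‖ ^ 2 / (2 * (L + 1) ^ 2) =
        1 / (L + 1) * ‖g‖ ^ 2 - L / 2 * (1 / (L + 1) * ‖g‖) ^ 2 := by
      field_simp; ring
    have h4 : 0 ≤ ‖g‖ ^ 2 / (2 * ((L : ℝ) + 1) ^ 2) := by positivity
    unfold gap
    linarith
  rw [div_le_iff₀ (by positivity)] at h3
  linarith

theorem lower_gradient_eq_zero {φ : EuclideanSpace ℝ (Fin m)} {y : EuclideanSpace ℝ (Fin n)}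
    (hy : y ∈ lowerSolutions f φ) : lower (gradient f (pt φ y)) = 0 := by
  have h := hf.norm_lower_gradient_sq_le φ y
  rw [gap, maxVal_eq hy, sub_self, mul_zero] at h
  exact norm_eq_zero.1 (pow_eq_zero_iff two_ne_zero |>.1 (le_antisymm h (sq_nonneg _)))

/-- The PL inequality implies an error bound: gradient ascent from `y` converges to a maximiser at
distance at most a multiple of the gradient norm. -/
theorem exists_near (φ : EuclideanSpace ℝ (Fin m)) (y : EuclideanSpace ℝ (Fin n)) :
    ∃ ystar ∈ lowerSolutions f φ,
      ‖y - ystar‖ ≤ errConst L μ * ‖lower (gradient f (pt φ y))‖ := by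
  have hL : (0 : ℝ) ≤ L := L.2
  have hμ := hf.mu_pos
  -- The step `1/M` satisfies `L/M ≤ 1` even for `L = 0`, and `M > μ` keeps the contraction factor
  -- `r` positive.
  set M : ℝ := L + μ + 1 with hM
  have hM0 : 0 < M := by positivity
  obtain ⟨hr0, hr1⟩ := ascentRate_mem (L := L) hμ
  set r := ascentRate L μ with hr
  have hs1 : Real.sqrt r < 1 := by rw [Real.sqrt_lt' one_pos]; linarith
  let u : ℕ → EuclideanSpace ℝ (Fin n) := fun k =>
    Nat.rec y (fun _ v => v + (1 / M) • lower (gradient f (pt φ v))) k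
  have hu : ∀ k, u (k + 1) = u k + (1 / M) • lower (gradient f (pt φ (u k))) := fun _ => rfl
  have hgap : ∀ k, gap f φ (u k) ≤ r ^ k * gap f φ y := by
    intro k
    induction k with
    | zero => simp [u]
    | succ k ih =>
      have h := hf.gap_step (τ := 1 / M) (by positivity)
        (by rw [one_div, inv_mul_le_iff₀ hM0]; linarith) φ (u k) (lower (gradient f (pt φ (u k))))
      rw [sub_self, norm_zero, ← hu] at h
      have h' : (1 - 1 / M * μ / 2) = r := by rw [hr, ascentRate, ← hM]; field_simp
      rw [h'] at h
      calc gap f φ (u (k + 1)) ≤ r * gap f φ (u k) := by simpa using h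
        _ ≤ r * (r ^ k * gap f φ y) := by gcongr
        _ = r ^ (k + 1) * gap f φ y := by ring
  set c := Real.sqrt (2 / (M * μ)) * ‖lower (gradient f (pt φ y))‖ with hc
  -- Squared step lengths are `‖∇‖²/M²`, with `‖∇‖² ≤ 2M · gap` at the current point, `gap ≤ r^k ·
  -- gap(y)`, and `gap(y) ≤ ‖∇(y)‖²/μ` by PL; hence the factor `2/(Mμ)`.
  have hdist : ∀ k, dist (u k) (u (k + 1)) ≤ c * Real.sqrt r ^ k := by
    intro k
    rw [hu, dist_self_add_right, norm_smul, Real.norm_of_nonneg (by positivity)]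
    refine abs_le_of_sq_le_sq' ?_ (by positivity) |>.2
    have h1 := hf.norm_lower_gradient_sq_le φ (u k)
    have h2 : 2 * ((L : ℝ) + 1) * gap f φ (u k) ≤ 2 * M * (r ^ k * gap f φ y) := by
      have := hf.gap_nonneg φ (u k)
      have := hgap k
      gcongr
      linarith
    have h3 := hf.mul_gap_le φ y
    have h4 : gap f φ y ≤ ‖lower (gradient f (pt φ y))‖ ^ 2 / μ := by
      rw [le_div_iff₀ hμ]; linarith
    have h5 : 2 * M * (r ^ k * gap f φ y) ≤
        2 * M * (r ^ k * (‖lower (gradient f (pt φ y))‖ ^ 2 / μ)) := by gcongr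
    have h6 : (c * Real.sqrt r ^ k) ^ 2 =
        2 / (M * μ) * ‖lower (gradient f (pt φ y))‖ ^ 2 * r ^ k := by
      rw [hc, mul_pow, mul_pow, Real.sq_sqrt (by positivity), ← pow_mul, mul_comm k 2, pow_mul,
        Real.sq_sqrt hr0.le]
    rw [h6, mul_pow]
    calc (1 / M) ^ 2 * ‖lower (gradient f (pt φ (u k)))‖ ^ 2
        ≤ (1 / M) ^ 2 * (2 * M * (r ^ k * (‖lower (gradient f (pt φ y))‖ ^ 2 / μ))) := by
          gcongr; linarith
      _ = _ := by field_simp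
  obtain ⟨ystar, hlim⟩ := cauchySeq_tendsto_of_complete (cauchySeq_of_le_geometric _ _ hs1 hdist)
  refine ⟨ystar, ?_, ?_⟩
  · have hcont : Filter.Tendsto (fun k => f (pt φ (u k))) Filter.atTop (nhds (f (pt φ ystar))) := by
      have hpt : Continuous fun w : EuclideanSpace ℝ (Fin n) => pt φ w :=
        (LipschitzWith.of_dist_le_mul (K := 1) fun w w' => by
          rw [dist_eq_norm, ← pt_sub, sub_self, norm_pt_zero_left, dist_eq_norm]; simp).continuous
      exact ((hf.diff.continuous.comp hpt).tendsto _).comp hlim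
    have hle : maxVal f φ - f (pt φ ystar) ≤ 0 := by
      refine le_of_tendsto_of_tendsto (hcont.const_sub (maxVal f φ)) ?_
        (Filter.Eventually.of_forall hgap)
      simpa using (tendsto_pow_atTop_nhds_zero_of_lt_one hr0.le hr1).mul_const (gap f φ y)
    exact fun w => (hf.le_maxVal φ w).trans (sub_nonpos.1 hle)
  · have h := dist_le_of_le_geometric_of_tendsto₀ _ _ hs1 hdist hlim
    rw [dist_eq_norm] at h
    refine h.trans (le_of_eq ?_)
    rw [hc, errConst]
    ring

theorem norm_gradient_sub_le (φ φ' : EuclideanSpace ℝ (Fin m)) (y y' : EuclideanSpace ℝ (Fin n)) :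
    ‖gradient f (pt φ y) - gradient f (pt φ' y')‖ ≤ L * ‖pt (φ - φ') (y - y')‖ := by
  have := hf.lip.dist_le_mul (pt φ y) (pt φ' y')
  rwa [dist_eq_norm, dist_eq_norm, ← pt_sub] at this

/-- The solution sets depend on `φ` in a Lipschitz way. -/
theorem exists_near_of_mem {φ : EuclideanSpace ℝ (Fin m)} {y : EuclideanSpace ℝ (Fin n)}
    (hy : y ∈ lowerSolutions f φ) (φ' : EuclideanSpace ℝ (Fin m)) :
    ∃ y' ∈ lowerSolutions f φ', ‖y' - y‖ ≤ errConst L μ * L * ‖φ' - φ‖ := by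
  obtain ⟨y', hy', h⟩ := hf.exists_near φ' y
  refine ⟨y', hy', ?_⟩
  rw [norm_sub_rev]
  refine h.trans ?_
  rw [mul_assoc]
  refine mul_le_mul_of_nonneg_left ?_ (errConst_nonneg hf.mu_pos)
  have h1 := hf.norm_gradient_sub_le φ' φ y y
  rw [sub_self, norm_pt_zero_right] at h1
  calc ‖lower (gradient f (pt φ' y))‖
      = ‖lower (gradient f (pt φ' y) - gradient f (pt φ y))‖ := by
        rw [lower_sub, hf.lower_gradient_eq_zero hy, sub_zero]
    _ ≤ _ := (norm_lower_le _).trans h1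

/-- Danskin's theorem for PL functions. -/
theorem hasGradientAt_maxVal {φ : EuclideanSpace ℝ (Fin m)} {y : EuclideanSpace ℝ (Fin n)}
    (hy : y ∈ lowerSolutions f φ) :
    HasGradientAt (maxVal f) (upper (gradient f (pt φ y))) φ := by
  have hL : (0 : ℝ) ≤ L := L.2
  refine hasGradientAt_of_quadratic_bound (C := L / 2 * (1 + (errConst L μ * L) ^ 2)) fun d => ?_
  obtain ⟨y', hy', hd⟩ := hf.exists_near_of_mem hy (φ + d)
  rw [add_sub_cancel_left] at hd
  -- The lower gradient vanishes at the maximiser, so the first-order term in `e` disappears. Then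
  -- `e = 0` bounds the new maximum from below, and `e = y' - y`, which is `O(‖d‖)`, from above.
  have key : ∀ e : EuclideanSpace ℝ (Fin n),
      |f (pt (φ + d) (y + e)) - f (pt φ y) - inner ℝ (upper (gradient f (pt φ y))) d| ≤
        L / 2 * (‖d‖ ^ 2 + ‖e‖ ^ 2) := fun e => by
    have h := abs_sub_inner_gradient_le hf.diff hf.lip (pt φ y) (pt d e)
    rwa [← pt_add, inner_pt, hf.lower_gradient_eq_zero hy, inner_zero_left, add_zero,
      norm_pt_sq] at h
  have h0 := abs_le.1 (key 0)
  have h1 := abs_le.1 (key (y' - y))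
  rw [add_sub_cancel] at h1
  rw [add_zero, norm_zero] at h0
  have h2 := hf.le_maxVal (φ + d) y
  have h3 : ‖y' - y‖ ^ 2 ≤ (errConst L μ * L) ^ 2 * ‖d‖ ^ 2 := by
    rw [← mul_pow]; gcongr
  have h4 : (L : ℝ) / 2 * ‖y' - y‖ ^ 2 ≤ L / 2 * ((errConst L μ * L) ^ 2 * ‖d‖ ^ 2) := by gcongr
  have h5 : 0 ≤ (L : ℝ) / 2 * ((errConst L μ * L) ^ 2 * ‖d‖ ^ 2) := by positivity
  rw [maxVal_eq hy', maxVal_eq hy, abs_le]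
  rw [maxVal_eq hy'] at h2
  constructor <;> nlinarith

/-- The gap at a new upper-level variable. -/
theorem gap_le_of_move (φ φ' : EuclideanSpace ℝ (Fin m)) (y : EuclideanSpace ℝ (Fin n)) :
    gap f φ' y ≤ 4 * (L + 1) / μ * gap f φ y + 2 * L ^ 2 / μ * ‖φ' - φ‖ ^ 2 := by
  have hμ := hf.mu_pos
  -- PL bounds the gap at `φ'` by the gradient there; this is within `L‖φ' - φ‖` of the gradient at
  -- `φ`, which the gap at `φ` controls.
  have h1 := hf.mul_gap_le φ' y
  have h2 := hf.norm_lower_gradient_sq_le φ y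
  have h3 := hf.norm_gradient_sub_le φ' φ y y
  rw [sub_self, norm_pt_zero_right] at h3
  have h4 := (norm_lower_le _).trans h3
  rw [lower_sub] at h4
  set a := lower (gradient f (pt φ' y))
  set b := lower (gradient f (pt φ y))
  have h5 : ‖a‖ ≤ ‖b‖ + ‖a - b‖ := norm_le_norm_add_norm_sub' a b
  have h6 : ‖a‖ ^ 2 ≤ 2 * ‖b‖ ^ 2 + 2 * ‖a - b‖ ^ 2 := by
    nlinarith [norm_nonneg a, norm_nonneg b, norm_nonneg (a - b), sq_nonneg (‖b‖ - ‖a - b‖)]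
  have h7 : ‖a - b‖ ^ 2 ≤ L ^ 2 * ‖φ' - φ‖ ^ 2 := by rw [← mul_pow]; gcongr
  have h8 : 4 * (L + 1) / μ * gap f φ y + 2 * L ^ 2 / μ * ‖φ' - φ‖ ^ 2 =
      (4 * (L + 1) * gap f φ y + 2 * (L ^ 2 * ‖φ' - φ‖ ^ 2)) / μ := by ring
  rw [h8, le_div_iff₀ hμ]
  linarith

end PLSmooth

end PolyakLojasiewicz

/-! ### Uniform smoothness of the proxies and their convergence to the hyper-objective -/

section HyperObjective

variable {m n : ℕ}

/-- At all maximisers the upper-level gradient is the same; at other points it differs from it by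
at most a multiple of the lower-level gradient. -/
theorem PLSmooth.norm_upper_gradient_sub_le {f : Joint m n → ℝ} {L : ℝ≥0} {μ : ℝ}
    (hf : PLSmooth f L μ) {φ : EuclideanSpace ℝ (Fin m)} {ystar : EuclideanSpace ℝ (Fin n)}
    (h : ystar ∈ lowerSolutions f φ) (y : EuclideanSpace ℝ (Fin n)) :
    ‖upper (gradient f (pt φ y)) - upper (gradient f (pt φ ystar))‖ ≤
      L * errConst L μ * ‖lower (gradient f (pt φ y))‖ := by
  obtain ⟨y', hy', hle⟩ := hf.exists_near φ y
  -- Danskin at both maximisers and uniqueness of the gradient allow `ystar` to be replaced by the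
  -- maximiser near `y`.
  rw [(hf.hasGradientAt_maxVal h).unique (hf.hasGradientAt_maxVal hy'), ← upper_sub]
  have h1 := hf.norm_gradient_sub_le φ φ y y'
  rw [sub_self, norm_pt_zero_left] at h1
  calc _ ≤ L * ‖y - y'‖ := (norm_upper_le _).trans h1
    _ ≤ L * (errConst L μ * ‖lower (gradient f (pt φ y))‖) := by gcongr
    _ = _ := by ring

theorem PLSmooth.norm_upper_gradient_sub_sq_le {f : Joint m n → ℝ} {L : ℝ≥0} {μ : ℝ}
    (hf : PLSmooth f L μ) {φ : EuclideanSpace ℝ (Fin m)} {ystar : EuclideanSpace ℝ (Fin n)}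
    (h : ystar ∈ lowerSolutions f φ) (y : EuclideanSpace ℝ (Fin n)) :
    ‖upper (gradient f (pt φ y)) - upper (gradient f (pt φ ystar))‖ ^ 2 ≤
      (L * errConst L μ) ^ 2 * (2 * (L + 1)) * gap f φ y := by
  have h1 := hf.norm_upper_gradient_sub_le h y
  have h2 := hf.norm_lower_gradient_sq_le φ y
  calc _ ≤ (L * errConst L μ * ‖lower (gradient f (pt φ y))‖) ^ 2 := by gcongr
    _ = (L * errConst L μ) ^ 2 * ‖lower (gradient f (pt φ y))‖ ^ 2 := by ring
    _ ≤ (L * errConst L μ) ^ 2 * (2 * (L + 1) * gap f φ y) := by gcongr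
    _ = _ := by ring

theorem penalty_zero (J G : Joint m n → ℝ) : penalty J G 0 = J := by
  funext z; simp [penalty]

namespace Regular

variable {J G : Joint m n → ℝ} {σ₀ μ : ℝ} {LJ Lh LH LG : ℝ≥0}
  (hreg : Regular J G σ₀ μ LJ Lh LH LG)
include hreg

theorem gradient_penalty (σ : ℝ) (z : Joint m n) :
    gradient (penalty J G σ) z = gradient J z - σ • gradient G z := by
  have hJ := (hreg.contDiff_J.differentiable (by norm_num)) z
  have hG := (hreg.contDiff_G.differentiable (by norm_num)) z
  have : fderiv ℝ (penalty J G σ) z = fderiv ℝ J z - σ • fderiv ℝ G z := by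
    unfold penalty
    rw [fderiv_fun_sub hJ (hG.const_mul σ), fderiv_const_mul hG]
  rw [gradient, this, map_sub, map_smulₛₗ]
  simp [gradient]

theorem contDiff_penalty (σ : ℝ) : ContDiff ℝ 2 (penalty J G σ) :=
  hreg.contDiff_J.sub (contDiff_const.mul hreg.contDiff_G)

theorem plSmooth {σ : ℝ} (h0 : 0 ≤ σ) (h1 : σ ≤ σ₀) : PLSmooth (penalty J G σ) Lh μ where
  mu_pos := hreg.mu_pos
  diff := (hreg.contDiff_penalty σ).differentiable (by norm_num)
  lip := hreg.smooth_h σ h0 h1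
  pl := hreg.pl σ h0 h1

theorem plSmooth_J : PLSmooth J LJ μ where
  mu_pos := hreg.mu_pos
  diff := hreg.contDiff_J.differentiable (by norm_num)
  lip := hreg.smooth_J
  pl := by simpa only [penalty_zero] using hreg.pl 0 le_rfl hreg.sigma_pos.le

theorem plSmooth_J' : PLSmooth J Lh μ := by
  simpa only [penalty_zero] using hreg.plSmooth le_rfl hreg.sigma_pos.le

theorem norm_gradient_G_le (z : Joint m n) : ‖gradient G z‖ ≤ LG :=
  norm_gradient_le_of_lipschitzWith hreg.lipschitz_G z

/-- Smoothness of `G` is inherited from the penalties, because `σ₀ G = h_0 - h_{σ₀}`. -/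
theorem norm_gradient_G_sub_le (z w : Joint m n) :
    ‖gradient G z - gradient G w‖ ≤ 2 * Lh / σ₀ * ‖z - w‖ := by
  have hσ := hreg.sigma_pos
  have h0 := hreg.plSmooth_J'.lip.dist_le_mul z w
  have h1 := (hreg.plSmooth hσ.le le_rfl).lip.dist_le_mul z w
  rw [dist_eq_norm, dist_eq_norm] at h0 h1
  rw [hreg.gradient_penalty, hreg.gradient_penalty] at h1
  have h2 : σ₀ • (gradient G z - gradient G w) = (gradient J z - gradient J w) -
      (gradient J z - σ₀ • gradient G z - (gradient J w - σ₀ • gradient G w)) := by module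
  have h3 : σ₀ * ‖gradient G z - gradient G w‖ ≤ 2 * Lh * ‖z - w‖ := by
    rw [← Real.norm_of_nonneg hσ.le, ← norm_smul, h2]
    refine (norm_sub_le _ _).trans ?_
    linarith
  rw [div_mul_eq_mul_div, le_div_iff₀ hσ]
  linarith

/-- Maximisers of `J` are close to maximisers of `h_σ`. -/
theorem exists_near_penalty {σ : ℝ} (h0 : 0 ≤ σ) (h1 : σ ≤ σ₀) {φ : EuclideanSpace ℝ (Fin m)}
    {y : EuclideanSpace ℝ (Fin n)} (hy : y ∈ lowerSolutions J φ) :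
    ∃ y' ∈ lowerSolutions (penalty J G σ) φ, ‖y' - y‖ ≤ errConst Lh μ * LG * σ := by
  obtain ⟨y', hy', h⟩ := (hreg.plSmooth h0 h1).exists_near φ y
  refine ⟨y', hy', ?_⟩
  rw [norm_sub_rev, mul_assoc]
  refine h.trans (mul_le_mul_of_nonneg_left ?_ (errConst_nonneg hreg.mu_pos))
  rw [hreg.gradient_penalty, lower_sub, hreg.plSmooth_J.lower_gradient_eq_zero hy, zero_sub,
    norm_neg, lower_smul, norm_smul, Real.norm_of_nonneg h0, mul_comm]
  exact mul_le_mul_of_nonneg_right ((norm_lower_le _).trans (hreg.norm_gradient_G_le _)) h0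

/-- Maximisers of `h_σ` are close to maximisers of `J`. -/
theorem exists_near_of_penalty {σ : ℝ} (h0 : 0 ≤ σ) (h1 : σ ≤ σ₀) {φ : EuclideanSpace ℝ (Fin m)}
    {y : EuclideanSpace ℝ (Fin n)} (hy : y ∈ lowerSolutions (penalty J G σ) φ) :
    ∃ y' ∈ lowerSolutions J φ, ‖y' - y‖ ≤ errConst Lh μ * LG * σ := by
  obtain ⟨y', hy', h⟩ := hreg.plSmooth_J'.exists_near φ y
  refine ⟨y', hy', ?_⟩
  rw [norm_sub_rev, mul_assoc]
  refine h.trans (mul_le_mul_of_nonneg_left ?_ (errConst_nonneg hreg.mu_pos))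
  have h2 := (hreg.plSmooth h0 h1).lower_gradient_eq_zero hy
  rw [hreg.gradient_penalty, lower_sub, sub_eq_zero] at h2
  rw [h2, lower_smul, norm_smul, Real.norm_of_nonneg h0, mul_comm]
  exact mul_le_mul_of_nonneg_right ((norm_lower_le _).trans (hreg.norm_gradient_G_le _)) h0

/-- Multiplied by `σ`, the expression to be minimised is `max J - h_σ`. This reduces the proxy to
two value functions covered by Danskin's theorem. -/
theorem proxyObjective_eq {σ : ℝ} (h0 : 0 < σ) (h1 : σ ≤ σ₀) (φ : EuclideanSpace ℝ (Fin m)) :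
    proxyObjective J G σ φ = (maxVal J φ - maxVal (penalty J G σ) φ) / σ := by
  have hh := hreg.plSmooth h0.le h1
  obtain ⟨ys, hys⟩ := hh.exists_mem φ
  have hval : ∀ y, G (pt φ y) + ((⨆ y', J (pt φ y')) - J (pt φ y)) / σ =
      (maxVal J φ - penalty J G σ (pt φ y)) / σ := fun y => by
    unfold maxVal penalty
    field_simp
    ring
  have hle : ∀ y, (maxVal J φ - maxVal (penalty J G σ) φ) / σ ≤
      (maxVal J φ - penalty J G σ (pt φ y)) / σ := fun y => by
    have := hh.le_maxVal φ y
    gcongr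
  unfold proxyObjective
  simp only [hval]
  refine le_antisymm ?_ (le_ciInf hle)
  rw [maxVal_eq hys]
  exact ciInf_le (f := fun y => (maxVal J φ - penalty J G σ (pt φ y)) / σ)
    ⟨_, Set.forall_mem_range.2 hle⟩ ys

theorem hasGradientAt_proxyObjective {σ : ℝ} (h0 : 0 < σ) (h1 : σ ≤ σ₀)
    {φ : EuclideanSpace ℝ (Fin m)} {y y' : EuclideanSpace ℝ (Fin n)}
    (hy : y ∈ lowerSolutions J φ) (hy' : y' ∈ lowerSolutions (penalty J G σ) φ) :
    HasGradientAt (proxyObjective J G σ)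
      ((1 / σ) • (upper (gradient J (pt φ y)) - upper (gradient (penalty J G σ) (pt φ y')))) φ := by
  have hJ := (hreg.plSmooth_J.hasGradientAt_maxVal hy).hasFDerivAt
  have hh := ((hreg.plSmooth h0.le h1).hasGradientAt_maxVal hy').hasFDerivAt
  have heq : proxyObjective J G σ =
      fun φ => (1 / σ) * (maxVal J φ - maxVal (penalty J G σ) φ) := by
    funext φ
    rw [hreg.proxyObjective_eq h0 h1]
    ring
  rw [heq, hasGradientAt_iff_hasFDerivAt, map_smulₛₗ, map_sub]
  exact (hJ.sub hh).const_mul (1 / σ)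

theorem gradient_proxyObjective {σ : ℝ} (h0 : 0 < σ) (h1 : σ ≤ σ₀)
    {φ : EuclideanSpace ℝ (Fin m)} {y y' : EuclideanSpace ℝ (Fin n)}
    (hy : y ∈ lowerSolutions J φ) (hy' : y' ∈ lowerSolutions (penalty J G σ) φ) :
    gradient (proxyObjective J G σ) φ =
      (1 / σ) • (upper (gradient J (pt φ y)) - upper (gradient (penalty J G σ) (pt φ y'))) :=
  (hreg.hasGradientAt_proxyObjective h0 h1 hy hy').gradient

theorem differentiable_proxyObjective {σ : ℝ} (h0 : 0 < σ) (h1 : σ ≤ σ₀) :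
    Differentiable ℝ (proxyObjective J G σ) := fun φ => by
  obtain ⟨y, hy⟩ := hreg.plSmooth_J.exists_mem φ
  obtain ⟨y', hy'⟩ := (hreg.plSmooth h0.le h1).exists_mem φ
  exact (hreg.hasGradientAt_proxyObjective h0 h1 hy hy').differentiableAt

/-- The proxy objectives are uniformly Lipschitz. -/
theorem norm_gradient_proxyObjective_le {σ : ℝ} (h0 : 0 < σ) (h1 : σ ≤ σ₀)
    (φ : EuclideanSpace ℝ (Fin m)) :
    ‖gradient (proxyObjective J G σ) φ‖ ≤ Lh * (errConst Lh μ * LG) + LG := by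
  obtain ⟨y, hy⟩ := hreg.plSmooth_J.exists_mem φ
  obtain ⟨y', hy', hd⟩ := hreg.exists_near_penalty h0.le h1 hy
  rw [hreg.gradient_proxyObjective h0 h1 hy hy', hreg.gradient_penalty, upper_sub, upper_smul]
  have h2 := hreg.plSmooth_J'.norm_gradient_sub_le φ φ y' y
  rw [sub_self, norm_pt_zero_left] at h2
  have h3 : ‖upper (gradient J (pt φ y)) - upper (gradient J (pt φ y'))‖ ≤
      Lh * (errConst Lh μ * LG * σ) := by
    rw [norm_sub_rev, ← upper_sub]
    refine ((norm_upper_le _).trans h2).trans ?_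
    gcongr
  -- The factor `1/σ` meets a difference of `∇J` at points `O(σ)` apart; the rest is a bounded
  -- gradient of `G`.
  have h4 : (1 / σ) • (upper (gradient J (pt φ y)) - (upper (gradient J (pt φ y')) -
      σ • upper (gradient G (pt φ y')))) =
      (1 / σ) • (upper (gradient J (pt φ y)) - upper (gradient J (pt φ y'))) +
        upper (gradient G (pt φ y')) := by
    rw [smul_sub, smul_sub, smul_sub, smul_smul, one_div_mul_cancel h0.ne', one_smul]
    abel
  rw [h4]
  refine (norm_add_le _ _).trans (add_le_add ?_ ((norm_upper_le _).trans
    (hreg.norm_gradient_G_le _)))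
  rw [norm_smul, Real.norm_of_nonneg (by positivity), one_div, inv_mul_le_iff₀ h0]
  linarith

/-- A uniform Lipschitz constant of the gradients of the proxy objectives. -/
theorem norm_gradient_proxyObjective_sub_le {σ : ℝ} (h0 : 0 < σ) (h1 : σ ≤ σ₀)
    (φ φ' : EuclideanSpace ℝ (Fin m)) :
    ‖gradient (proxyObjective J G σ) φ' - gradient (proxyObjective J G σ) φ‖ ≤
      (1 + Lh * errConst Lh μ) * (LH * (errConst Lh μ * LG) + 2 * Lh / σ₀) *
        (1 + errConst Lh μ * Lh) * ‖φ' - φ‖ := by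
  have hσ₀ := hreg.sigma_pos
  have hκ := errConst_nonneg (L := Lh) hreg.mu_pos
  have hLh : (0 : ℝ) ≤ Lh := Lh.2
  have hLH : (0 : ℝ) ≤ LH := LH.2
  have hLG : (0 : ℝ) ≤ LG := LG.2
  have hh := hreg.plSmooth h0.le h1
  obtain ⟨y₀, hy₀⟩ := hreg.plSmooth_J.exists_mem φ
  obtain ⟨ys, hys, hds⟩ := hreg.exists_near_penalty h0.le h1 hy₀
  obtain ⟨y₁, hy₁, hd₁⟩ := hreg.plSmooth_J'.exists_near_of_mem hy₀ φ'
  obtain ⟨yt, hyt⟩ := hh.exists_mem φ'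
  rw [hreg.gradient_proxyObjective h0 h1 hy₀ hys, hreg.gradient_proxyObjective h0 h1 hy₁ hyt]
  -- The parallelogram: `z` and `z + b` are maximisers of `J` at `φ` and `φ'`, `z + a` is a
  -- maximiser of `h_σ` at `φ`, and `z + a + b` is the candidate for an approximate maximiser of
  -- `h_σ` at `φ'`.
  set z := pt φ y₀ with hz
  set a := pt (0 : EuclideanSpace ℝ (Fin m)) (ys - y₀) with ha
  set b := pt (φ' - φ) (y₁ - y₀) with hb
  have hza : pt φ ys = z + a := by rw [hz, ha, ← pt_add]; congr 1 <;> abel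
  have hzb : pt φ' y₁ = z + b := by rw [hz, hb, ← pt_add]; congr 1 <;> abel
  have hzab : pt φ' (ys + y₁ - y₀) = z + a + b := by
    rw [hz, ha, hb, ← pt_add, ← pt_add]; congr 1 <;> abel
  have hna : ‖a‖ ≤ errConst Lh μ * LG * σ := by rw [ha, norm_pt_zero_left]; exact hds
  have hnb : ‖b‖ ≤ (1 + errConst Lh μ * Lh) * ‖φ' - φ‖ := by
    refine (norm_pt_le _ _).trans ?_
    linarith
  set Δ := gradient (penalty J G σ) (z + a + b) - gradient (penalty J G σ) (z + a) -
    gradient J (z + b) + gradient J z with hΔ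
  -- Replacing `∇J` by `∇h_σ + σ∇G` turns `Δ` into a genuine second difference of `∇h_σ` plus an
  -- increment of `σ∇G`; both are `O(σ‖b‖)`.
  have hΔ' : Δ = (gradient (penalty J G σ) (z + a + b) - gradient (penalty J G σ) (z + a) -
      gradient (penalty J G σ) (z + b) + gradient (penalty J G σ) z) -
      σ • (gradient G (z + b) - gradient G z) := by
    rw [hΔ, hreg.gradient_penalty σ (z + b), hreg.gradient_penalty σ z]
    module
  have hΔn : ‖Δ‖ ≤ (LH * (errConst Lh μ * LG) + 2 * Lh / σ₀) * σ * ‖b‖ := by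
    have e1 := norm_second_difference_le (differentiable_gradient (hreg.contDiff_penalty σ))
      (hreg.hessian_h σ h0.le h1) z a b
    have e2 := hreg.norm_gradient_G_sub_le (z + b) z
    rw [add_sub_cancel_left] at e2
    rw [hΔ']
    calc _ ≤ LH * ‖a‖ * ‖b‖ + σ * (2 * Lh / σ₀ * ‖b‖) := by
          refine (norm_sub_le _ _).trans (add_le_add e1 ?_)
          rw [norm_smul, Real.norm_of_nonneg h0.le]
          gcongr
      _ ≤ LH * (errConst Lh μ * LG * σ) * ‖b‖ + σ * (2 * Lh / σ₀ * ‖b‖) := by gcongr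
      _ = _ := by ring
  -- The other three corners are maximisers for the functions whose gradients appear there, so they
  -- contribute nothing to the lower block.
  have hlow : lower (gradient (penalty J G σ) (z + a + b)) = lower Δ := by
    rw [hΔ, lower_add, lower_sub, lower_sub, ← hza, hh.lower_gradient_eq_zero hys, ← hzb,
      hreg.plSmooth_J.lower_gradient_eq_zero hy₁, hz, hreg.plSmooth_J.lower_gradient_eq_zero hy₀]
    simp
  have hup := hh.norm_upper_gradient_sub_le hyt (ys + y₁ - y₀)
  rw [hzab, hlow] at hup
  have hsplit : (upper (gradient J (pt φ' y₁)) - upper (gradient (penalty J G σ) (pt φ' yt))) -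
      (upper (gradient J z) - upper (gradient (penalty J G σ) (pt φ ys))) =
      (upper (gradient (penalty J G σ) (z + a + b)) -
        upper (gradient (penalty J G σ) (pt φ' yt))) - upper Δ := by
    rw [hΔ, hza, hzb, upper_add, upper_sub, upper_sub]
    abel
  rw [← smul_sub, hsplit, norm_smul, Real.norm_of_nonneg (by positivity), one_div,
    inv_mul_le_iff₀ h0]
  calc _ ≤ Lh * errConst Lh μ * ‖Δ‖ + ‖Δ‖ := by
        refine (norm_sub_le _ _).trans (add_le_add (hup.trans ?_) (norm_upper_le _))
        gcongr
        exact norm_lower_le _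
    _ = (1 + Lh * errConst Lh μ) * ‖Δ‖ := by ring
    _ ≤ (1 + Lh * errConst Lh μ) * ((LH * (errConst Lh μ * LG) + 2 * Lh / σ₀) * σ *
          ((1 + errConst Lh μ * Lh) * ‖φ' - φ‖)) := by
        gcongr
        exact hΔn.trans (by gcongr)
    _ = _ := by ring

theorem exists_proxySmooth : ∃ L : ℝ≥0, ProxySmooth J G σ₀ L := by
  refine ⟨Real.toNNReal ((1 + Lh * errConst Lh μ) *
    (LH * (errConst Lh μ * LG) + 2 * Lh / σ₀) * (1 + errConst Lh μ * Lh)), fun σ h0 h1 =>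
    ⟨hreg.differentiable_proxyObjective h0 h1, LipschitzWith.of_dist_le_mul fun φ' φ => ?_⟩⟩
  rw [dist_eq_norm, dist_eq_norm]
  refine (hreg.norm_gradient_proxyObjective_sub_le h0 h1 φ φ').trans ?_
  gcongr
  exact Real.le_coe_toNNReal _

/-- The gradients of the proxy objectives change by `O(σ)` when `σ` is doubled. -/
theorem norm_gradient_proxyObjective_double_sub_le {σ : ℝ} (h0 : 0 < σ) (h1 : 2 * σ ≤ σ₀)
    (φ : EuclideanSpace ℝ (Fin m)) :
    ‖gradient (proxyObjective J G (2 * σ)) φ - gradient (proxyObjective J G σ) φ‖ ≤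
      (1 + Lh * errConst Lh μ) * (LH * (errConst Lh μ * LG) ^ 2 +
        2 * (2 * Lh / σ₀ * (errConst Lh μ * LG))) * σ := by
  have hσ₀ := hreg.sigma_pos
  have hκ := errConst_nonneg (L := Lh) hreg.mu_pos
  have hLh : (0 : ℝ) ≤ Lh := Lh.2
  have hLH : (0 : ℝ) ≤ LH := LH.2
  have hLG : (0 : ℝ) ≤ LG := LG.2
  have h2 : 0 < 2 * σ := by linarith
  have h3 : σ ≤ σ₀ := by linarith
  have hh := hreg.plSmooth h0.le h3
  have hh2 := hreg.plSmooth h2.le h1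
  obtain ⟨y₀, hy₀⟩ := hreg.plSmooth_J.exists_mem φ
  obtain ⟨ys, hys, hds⟩ := hreg.exists_near_penalty h0.le h3 hy₀
  obtain ⟨yt, hyt⟩ := hh2.exists_mem φ
  rw [hreg.gradient_proxyObjective h0 h3 hy₀ hys, hreg.gradient_proxyObjective h2 h1 hy₀ hyt]
  -- Degenerate parallelogram with both sides `a`: the point `z + 2a` is the candidate for an
  -- approximate maximiser of `h_{2σ}`. The combination `Δ` reflects `2h_σ = h_{2σ} + J`.
  set z := pt φ y₀ with hz
  set a := pt (0 : EuclideanSpace ℝ (Fin m)) (ys - y₀) with ha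
  have hza : pt φ ys = z + a := by rw [hz, ha, ← pt_add]; congr 1 <;> abel
  have hzaa : pt φ (ys + ys - y₀) = z + a + a := by
    rw [hz, ha, ← pt_add, ← pt_add]; congr 1 <;> abel
  have hna : ‖a‖ ≤ errConst Lh μ * LG * σ := by rw [ha, norm_pt_zero_left]; exact hds
  set Δ := gradient (penalty J G (2 * σ)) (z + a + a) -
    (2 : ℝ) • gradient (penalty J G σ) (z + a) + gradient J z with hΔ
  have hΔ' : Δ = (gradient (penalty J G (2 * σ)) (z + a + a) -
      gradient (penalty J G (2 * σ)) (z + a) - gradient (penalty J G (2 * σ)) (z + a) +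
      gradient (penalty J G (2 * σ)) z) -
      (2 * σ) • (gradient G (z + a) - gradient G z) := by
    rw [hΔ, hreg.gradient_penalty (2 * σ) (z + a), hreg.gradient_penalty (2 * σ) z,
      hreg.gradient_penalty σ (z + a)]
    module
  have hΔn : ‖Δ‖ ≤ (LH * (errConst Lh μ * LG) ^ 2 +
      2 * (2 * Lh / σ₀ * (errConst Lh μ * LG))) * σ ^ 2 := by
    have e1 := norm_second_difference_le (differentiable_gradient (hreg.contDiff_penalty (2 * σ)))
      (hreg.hessian_h (2 * σ) h2.le h1) z a a
    have e2 := hreg.norm_gradient_G_sub_le (z + a) z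
    rw [add_sub_cancel_left] at e2
    rw [hΔ']
    calc _ ≤ LH * ‖a‖ * ‖a‖ + (2 * σ) * (2 * Lh / σ₀ * ‖a‖) := by
          refine (norm_sub_le _ _).trans (add_le_add e1 ?_)
          rw [norm_smul, Real.norm_of_nonneg h2.le]
          gcongr
      _ ≤ LH * (errConst Lh μ * LG * σ) * (errConst Lh μ * LG * σ) +
          (2 * σ) * (2 * Lh / σ₀ * (errConst Lh μ * LG * σ)) := by gcongr
      _ = _ := by ring
  have hlow : lower (gradient (penalty J G (2 * σ)) (z + a + a)) = lower Δ := by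
    rw [hΔ, lower_add, lower_sub, lower_smul, ← hza, hh.lower_gradient_eq_zero hys,
      hz, hreg.plSmooth_J.lower_gradient_eq_zero hy₀]
    simp
  have hup := hh2.norm_upper_gradient_sub_le hyt (ys + ys - y₀)
  rw [hzaa, hlow] at hup
  have hsplit : (1 / (2 * σ)) • (upper (gradient J z) -
        upper (gradient (penalty J G (2 * σ)) (pt φ yt))) -
      (1 / σ) • (upper (gradient J z) - upper (gradient (penalty J G σ) (pt φ ys))) =
      (1 / (2 * σ)) • ((upper (gradient (penalty J G (2 * σ)) (z + a + a)) -
        upper (gradient (penalty J G (2 * σ)) (pt φ yt))) - upper Δ) := by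
    have : 1 / σ = 1 / (2 * σ) * 2 := by field_simp
    rw [this, mul_smul, ← smul_sub, hΔ, hza, upper_add, upper_sub, upper_smul]
    congr 1
    module
  rw [hsplit, norm_smul, Real.norm_of_nonneg (by positivity), one_div, inv_mul_le_iff₀ h2]
  calc _ ≤ Lh * errConst Lh μ * ‖Δ‖ + ‖Δ‖ := by
        refine (norm_sub_le _ _).trans (add_le_add (hup.trans ?_) (norm_upper_le _))
        gcongr
        exact norm_lower_le _
    _ = (1 + Lh * errConst Lh μ) * ‖Δ‖ := by ring
    _ ≤ (1 + Lh * errConst Lh μ) * ((LH * (errConst Lh μ * LG) ^ 2 +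
          2 * (2 * Lh / σ₀ * (errConst Lh μ * LG))) * σ ^ 2) := by gcongr
    -- Division is by `2σ`, so half of the claimed constant would suffice; the factor 2 is given
    -- away.
    _ = 1 * ((1 + Lh * errConst Lh μ) * (LH * (errConst Lh μ * LG) ^ 2 +
          2 * (2 * Lh / σ₀ * (errConst Lh μ * LG))) * σ * σ) := by ring
    _ ≤ 2 * ((1 + Lh * errConst Lh μ) * (LH * (errConst Lh μ * LG) ^ 2 +
          2 * (2 * Lh / σ₀ * (errConst Lh μ * LG))) * σ * σ) := by
        gcongr
        norm_num
    _ = _ := by ring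

theorem proxyObjective_le_of_mem {σ : ℝ} (h0 : 0 < σ) (h1 : σ ≤ σ₀)
    {φ : EuclideanSpace ℝ (Fin m)} {y : EuclideanSpace ℝ (Fin n)}
    (hy : y ∈ lowerSolutions J φ) : proxyObjective J G σ φ ≤ G (pt φ y) := by
  rw [hreg.proxyObjective_eq h0 h1, maxVal_eq hy, div_le_iff₀ h0]
  have := (hreg.plSmooth h0.le h1).le_maxVal φ y
  unfold penalty at this ⊢
  linarith

theorem proxyObjective_le {σ : ℝ} (h0 : 0 < σ) (h1 : σ ≤ σ₀) (φ : EuclideanSpace ℝ (Fin m)) :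
    proxyObjective J G σ φ ≤ hyperObjective J G φ := by
  obtain ⟨y, hy⟩ := hreg.plSmooth_J.exists_mem φ
  refine le_csInf ⟨_, y, hy, rfl⟩ ?_
  rintro _ ⟨y', hy', rfl⟩
  exact hreg.proxyObjective_le_of_mem h0 h1 hy'

/-- A maximiser of `h_σ` attains the proxy value, and its penalty term is nonnegative, so `G` there
is at most `Φ_σ`. Moving to a lower-level solution at distance `O(σ)` changes `G` by `O(σ)`. -/
theorem hyperObjective_le {σ : ℝ} (h0 : 0 < σ) (h1 : σ ≤ σ₀) (φ : EuclideanSpace ℝ (Fin m)) :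
    hyperObjective J G φ ≤ proxyObjective J G σ φ + LG * (errConst Lh μ * LG) * σ := by
  obtain ⟨y, hy⟩ := (hreg.plSmooth h0.le h1).exists_mem φ
  obtain ⟨y', hy', hd⟩ := hreg.exists_near_of_penalty h0.le h1 hy
  have h2 : hyperObjective J G φ ≤ G (pt φ y') := by
    refine csInf_le ⟨proxyObjective J G σ φ, ?_⟩ ⟨y', hy', rfl⟩
    rintro _ ⟨w, hw, rfl⟩
    exact hreg.proxyObjective_le_of_mem h0 h1 hw
  have h3 : G (pt φ y) ≤ proxyObjective J G σ φ := by
    rw [hreg.proxyObjective_eq h0 h1, maxVal_eq hy, le_div_iff₀ h0]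
    have := hreg.plSmooth_J.le_maxVal φ y
    unfold penalty
    linarith
  have h4 := hreg.lipschitz_G.dist_le_mul (pt φ y') (pt φ y)
  rw [dist_eq_norm, dist_eq_norm, ← pt_sub, sub_self, norm_pt_zero_left] at h4
  have h5 : (LG : ℝ) * ‖y' - y‖ ≤ LG * (errConst Lh μ * LG * σ) := by gcongr
  have h6 := (le_abs_self _).trans h4
  linarith

/-- The rate at which the gradient of the proxy objective converges to the hypergradient. -/
theorem exists_hasGradientAt_hyperObjective : ∃ C : ℝ, 0 ≤ C ∧
    ∀ φ : EuclideanSpace ℝ (Fin m), ∀ σ : ℝ, 0 < σ → σ ≤ σ₀ →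
      ∃ g, HasGradientAt (hyperObjective J G) g φ ∧
        ‖gradient (proxyObjective J G σ) φ - g‖ ≤ C * σ := by
  obtain ⟨L, hL⟩ := hreg.exists_proxySmooth
  have hσ₀ := hreg.sigma_pos
  have hκ := errConst_nonneg (L := Lh) hreg.mu_pos
  have hLh : (0 : ℝ) ≤ Lh := Lh.2
  set C := (1 + Lh * errConst Lh μ) * (LH * (errConst Lh μ * LG) ^ 2 +
        2 * (2 * Lh / σ₀ * (errConst Lh μ * LG))) with hC
  refine ⟨C, by positivity, fun φ σ h0 h1 => ?_⟩
  let s : ℕ → ℝ := fun k => σ * (1 / 2) ^ k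
  have hs0 : ∀ k, 0 < s k := fun k => by positivity
  have hs1 : ∀ k, s k ≤ σ₀ := fun k =>
    (mul_le_of_le_one_right h0.le (pow_le_one₀ (by norm_num) (by norm_num))).trans h1
  have hs2 : ∀ k, s k = 2 * s (k + 1) := fun k => by simp only [s, pow_succ]; ring
  have hslim : Filter.Tendsto s Filter.atTop (nhds 0) := by
    simpa [s] using (tendsto_pow_atTop_nhds_zero_of_lt_one (r := (1 / 2 : ℝ))
      (by norm_num) (by norm_num)).const_mul σ
  let q : ℕ → EuclideanSpace ℝ (Fin m) := fun k => gradient (proxyObjective J G (s k)) φ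
  -- The doubling estimate is used at `s (k + 1)`. The increments sum to `C σ`, so the constant is
  -- unchanged in the limit.
  have hq : ∀ k, dist (q k) (q (k + 1)) ≤ C * σ / 2 * (1 / 2) ^ k := fun k => by
    have h := hreg.norm_gradient_proxyObjective_double_sub_le (hs0 (k + 1))
      ((hs2 k).symm.trans_le (hs1 k)) φ
    rw [← hs2, ← dist_eq_norm] at h
    refine h.trans (le_of_eq ?_)
    simp only [s, hC, pow_succ]
    ring
  obtain ⟨g, hg⟩ := cauchySeq_tendsto_of_complete
    (cauchySeq_of_le_geometric _ _ (by norm_num) hq)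
  refine ⟨g, hasGradientAt_of_quadratic_bound (C := L / 2) fun d => ?_, ?_⟩
  · have hlim : ∀ ψ, Filter.Tendsto (fun k => proxyObjective J G (s k) ψ) Filter.atTop
        (nhds (hyperObjective J G ψ)) := fun ψ => by
      refine tendsto_of_tendsto_of_tendsto_of_le_of_le (g := fun k =>
        hyperObjective J G ψ - LG * (errConst Lh μ * LG) * s k) ?_ tendsto_const_nhds
        (fun k => ?_) (fun k => hreg.proxyObjective_le (hs0 k) (hs1 k) ψ)
      · simpa using (hslim.const_mul (LG * (errConst Lh μ * LG) : ℝ)).const_sub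
          (hyperObjective J G ψ)
      · have := hreg.hyperObjective_le (hs0 k) (hs1 k) ψ
        simp only
        linarith
    -- The quadratic bounds for the proxies share one constant `L/2`, so they survive the limit and
    -- identify `g` as the gradient.
    refine le_of_tendsto ((((hlim (φ + d)).sub (hlim φ)).sub
      (hg.inner (𝕜 := ℝ) tendsto_const_nhds)).abs) (Filter.Eventually.of_forall fun k => ?_)
    obtain ⟨hd, hl⟩ := hL (s k) (hs0 k) (hs1 k)
    exact abs_sub_inner_gradient_le hd hl φ d
  · have h := dist_le_of_le_geometric_of_tendsto₀ _ _ (by norm_num) hq hg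
    rw [dist_eq_norm] at h
    have h2 : q 0 = gradient (proxyObjective J G σ) φ := by simp [q, s]
    rw [h2] at h
    refine h.trans (le_of_eq ?_)
    ring

theorem differentiable_hyperObjective : Differentiable ℝ (hyperObjective J G) := fun φ => by
  obtain ⟨C, _, hC⟩ := hreg.exists_hasGradientAt_hyperObjective
  obtain ⟨g, hg, _⟩ := hC φ σ₀ hreg.sigma_pos le_rfl
  exact hg.differentiableAt

theorem exists_norm_gradient_sub_le : ∃ C : ℝ, 0 ≤ C ∧
    ∀ φ : EuclideanSpace ℝ (Fin m), ∀ σ : ℝ, 0 < σ → σ ≤ σ₀ →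
      ‖gradient (proxyObjective J G σ) φ - gradient (hyperObjective J G) φ‖ ≤ C * σ := by
  obtain ⟨C, hC0, hC⟩ := hreg.exists_hasGradientAt_hyperObjective
  refine ⟨C, hC0, fun φ σ h0 h1 => ?_⟩
  obtain ⟨g, hg, h⟩ := hC φ σ h0 h1
  rwa [hg.gradient]

end Regular

end HyperObjective

/-! ### Mean bounds that carry integrability along -/

section MeanBounds

variable {Ω : Type*} [MeasurableSpace Ω] {P : Measure Ω}

/-- `X` is integrable with mean at most `c`. -/
def MeanLE (P : Measure Ω) (X : Ω → ℝ) (c : ℝ) : Prop := Integrable X P ∧ ∫ ω, X ω ∂P ≤ c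

namespace MeanLE

variable {X Y : Ω → ℝ} {a b : ℝ}

theorem add (hX : MeanLE P X a) (hY : MeanLE P Y b) : MeanLE P (fun ω => X ω + Y ω) (a + b) :=
  ⟨hX.1.add hY.1, by rw [integral_add hX.1 hY.1]; exact add_le_add hX.2 hY.2⟩

theorem const_mul (hX : MeanLE P X a) {c : ℝ} (hc : 0 ≤ c) : MeanLE P (fun ω => c * X ω) (c * a) :=
  ⟨hX.1.const_mul c, by rw [integral_const_mul]; exact mul_le_mul_of_nonneg_left hX.2 hc⟩

theorem const [IsProbabilityMeasure P] (c : ℝ) : MeanLE P (fun _ => c) c :=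
  ⟨integrable_const c, by simp⟩

theorem le (hX : MeanLE P X a) (h : a ≤ b) : MeanLE P X b := ⟨hX.1, hX.2.trans h⟩

theorem mono (hY : MeanLE P Y a) (hX : Measurable X) (h0 : ∀ ω, 0 ≤ X ω) (h : ∀ ω, X ω ≤ Y ω) :
    MeanLE P X a := by
  have hi : Integrable X P := hY.1.mono' hX.aestronglyMeasurable
    (Filter.Eventually.of_forall fun ω => by rw [Real.norm_of_nonneg (h0 ω)]; exact h ω)
  exact ⟨hi, (integral_mono hi hY.1 h).trans hY.2⟩

theorem sum {ι : Type*} {s : Finset ι} {X : ι → Ω → ℝ} {a : ι → ℝ}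
    (h : ∀ i ∈ s, MeanLE P (X i) (a i)) : MeanLE P (fun ω => ∑ i ∈ s, X i ω) (∑ i ∈ s, a i) :=
  ⟨integrable_finsetSum s fun i hi => (h i hi).1, by
    rw [integral_finsetSum s fun i hi => (h i hi).1]
    exact Finset.sum_le_sum fun i hi => (h i hi).2⟩

/-- For nonnegative functions a finite bound on the lower integral encodes integrability and the
mean bound at once, so Tonelli applies with no prior integrability. -/
theorem iff_lintegral (hX : Measurable X) (h0 : ∀ ω, 0 ≤ X ω) (ha : 0 ≤ a) :
    MeanLE P X a ↔ ∫⁻ ω, ENNReal.ofReal (X ω) ∂P ≤ ENNReal.ofReal a := by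
  constructor
  · rintro ⟨hi, hle⟩
    rw [← ofReal_integral_eq_lintegral_ofReal hi (Filter.Eventually.of_forall h0)]
    exact ENNReal.ofReal_le_ofReal hle
  · intro h
    have hi : Integrable X P := (lintegral_ofReal_ne_top_iff_integrable hX.aestronglyMeasurable
      (Filter.Eventually.of_forall h0)).1 (h.trans_lt ENNReal.ofReal_lt_top).ne
    refine ⟨hi, ?_⟩
    rwa [← ofReal_integral_eq_lintegral_ofReal hi (Filter.Eventually.of_forall h0),
      ENNReal.ofReal_le_ofReal_iff ha] at h

/-- A bound on the mean that holds when one of two independent variables is frozen holds without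
freezing it. -/
theorem of_indepFun [IsProbabilityMeasure P] {A W : Type*} [MeasurableSpace A] [MeasurableSpace W]
    {Z : Ω → A} {V : Ω → W} (hZ : Measurable Z) (hV : Measurable V) (hind : IndepFun Z V P)
    {H : A × W → ℝ} (hH : Measurable H) (h0 : ∀ p, 0 ≤ H p) (ha : 0 ≤ a)
    (h : ∀ z, MeanLE P (fun ω => H (z, V ω)) a) : MeanLE P (fun ω => H (Z ω, V ω)) a := by
  have := Measure.isProbabilityMeasure_map hZ.aemeasurable (μ := P)
  have := Measure.isProbabilityMeasure_map hV.aemeasurable (μ := P)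
  refine (iff_lintegral (X := fun ω => H (Z ω, V ω)) (hH.comp (hZ.prodMk hV)) (fun _ => h0 _)
    ha).2 ?_
  have hm : Measurable fun p => ENNReal.ofReal (H p) := ENNReal.measurable_ofReal.comp hH
  -- Independence makes the joint law a product; the inner integral is then at most `a` for every
  -- frozen `z`.
  rw [← lintegral_map (f := fun p => ENNReal.ofReal (H p)) hm (hZ.prodMk hV),
    hind.map_prod_eq_prod_map_map hZ.aemeasurable hV.aemeasurable, lintegral_prod _ hm.aemeasurable]
  calc _ ≤ ∫⁻ _, ENNReal.ofReal a ∂P.map Z := by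
        refine lintegral_mono fun z => ?_
        rw [lintegral_map (f := fun y => ENNReal.ofReal (H (z, y))) (hm.comp measurable_prodMk_left) hV]
        exact (iff_lintegral (hH.comp (measurable_prodMk_left.comp hV)) (fun _ => h0 _) ha).1 (h z)
    _ = ENNReal.ofReal a := by simp

end MeanLE

end MeanBounds

/-! ### Minibatch variance at fixed and at random points -/

section Minibatch

variable {m n : ℕ}

/-- The second moment of an average of independent centred random vectors. -/
theorem meanLE_norm_sq_average {Ω E : Type*} [MeasurableSpace Ω] {P : Measure Ω}
    [NormedAddCommGroup E] [InnerProductSpace ℝ E] [CompleteSpace E] [MeasurableSpace E]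
    [BorelSpace E] {X : ℕ → Ω → E} {v : ℝ}
    (hint : ∀ j, Integrable (X j) P) (hind : Pairwise fun i j => IndepFun (X i) (X j) P)
    (hmean : ∀ j, ∫ ω, X j ω ∂P = 0) (hsq : ∀ j, MeanLE P (fun ω => ‖X j ω‖ ^ 2) v)
    {B : ℕ} (hB : 1 ≤ B) :
    MeanLE P (fun ω => ‖(1 / (B : ℝ)) • ∑ j ∈ Finset.range B, X j ω‖ ^ 2) (v / B) := by
  have hB0 : (0 : ℝ) < B := by exact_mod_cast hB
  -- Off-diagonal terms have mean zero, so only `B` of the `B²` terms contribute.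
  have hcross : ∀ i j, MeanLE P (fun ω => inner ℝ (X i ω) (X j ω)) (if i = j then v else 0) := by
    intro i j
    by_cases hij : i = j
    · subst hij
      simpa using hsq i
    · rw [if_neg hij]
      have h1 := (hind hij).integral_bilin (hint i) (hint j) (innerSL ℝ)
      have h2 := (hind hij).integrable_bilin (hint i) (hint j) (innerSL ℝ)
      rw [hmean i] at h1
      simp only [map_zero, zero_apply] at h1 h2
      exact ⟨h2, h1.le⟩
  have hsum := (MeanLE.sum (s := Finset.range B) fun i _ =>
    MeanLE.sum (s := Finset.range B) fun j _ => hcross i j).const_mul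
      (c := (1 / (B : ℝ)) ^ 2) (by positivity)
  have hval : (1 / (B : ℝ)) ^ 2 *
      ∑ i ∈ Finset.range B, ∑ j ∈ Finset.range B, (if i = j then v else 0) = v / B := by
    have : ∀ i ∈ Finset.range B, ∑ j ∈ Finset.range B, (if i = j then v else 0) = v := by
      intro i hi
      rw [Finset.sum_ite_eq, if_pos hi]
    rw [Finset.sum_congr rfl this, Finset.sum_const, Finset.card_range, nsmul_eq_mul]
    field_simp
  rw [hval] at hsum
  convert hsum using 2 with ω
  rw [norm_smul, mul_pow, Real.norm_of_nonneg (by positivity), ← real_inner_self_eq_norm_sq,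
    sum_inner]
  simp only [inner_sum]

theorem measurable_minibatch {Ξ : Type*} [MeasurableSpace Ξ] {g : Joint m n → Ξ → Joint m n}
    (hg : Measurable fun p : Joint m n × Ξ => g p.1 p.2) (B : ℕ) :
    Measurable fun p : Joint m n × (ℕ → Ξ) => minibatch g B p.1 p.2 := by
  have h : Measurable fun p : Joint m n × (ℕ → Ξ) => ∑ j ∈ Finset.range B, g p.1 (p.2 j) :=
    Finset.measurable_fun_sum _ fun j _ =>
      hg.comp (measurable_fst.prodMk ((measurable_pi_apply j).comp measurable_snd))
  exact h.const_smul (1 / (B : ℝ))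

theorem minibatch_sub {Ξ : Type*} (g : Joint m n → Ξ → Joint m n) {B : ℕ} (hB : 1 ≤ B)
    (z w : Joint m n) (x : ℕ → Ξ) :
    minibatch g B z x - w = (1 / (B : ℝ)) • ∑ j ∈ Finset.range B, (g z (x j) - w) := by
  have hB0 : (B : ℝ) ≠ 0 := by positivity
  rw [Finset.sum_sub_distrib, Finset.sum_const, Finset.card_range, smul_sub, minibatch,
    ← Nat.cast_smul_eq_nsmul ℝ, smul_smul, one_div_mul_cancel hB0, one_smul]

namespace SamplingModel

variable {J G : Joint m n → ℝ} {sJ sG : ℝ} (S : SamplingModel J G sJ sG)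

/-- The minibatch at a fixed point. -/
theorem meanLE_minibatch_fixed {f : Joint m n → ℝ} {g : Joint m n → S.Ξ → Joint m n} {s : ℝ}
    (hg : IsStochGradient S.D f g s) {l : ℕ → Label} (hl : l.Injective) {B : ℕ} (hB : 1 ≤ B)
    (z : Joint m n) :
    MeanLE S.P (fun ω => ‖minibatch g B z (fun j => S.sample (l j) ω) - gradient f z‖ ^ 2)
      (s ^ 2 / B) := by
  simp only [minibatch_sub g hB]
  have hgz : Measurable (g z) := hg.measurable.comp measurable_prodMk_left
  have he : Measurable fun ξ => g z ξ - gradient f z := hgz.sub_const _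
  have hmp : ∀ j, MeasurePreserving (S.sample j) S.P S.D := fun j =>
    ⟨S.measurable_sample j, S.law_sample j⟩
  have hint : Integrable (fun ξ => g z ξ - gradient f z) S.D := (hg.integrable z).sub
    (integrable_const _)
  refine meanLE_norm_sq_average (X := fun j ω => g z (S.sample (l j) ω) - gradient f z)
    (fun j => (hmp (l j)).integrable_comp_of_integrable hint)
    (fun i j hij => (S.indep_sample.indepFun (hl.ne hij)).comp he he) (fun j => ?_)
    (fun j => ⟨(hmp (l j)).integrable_comp_of_integrable (hg.integrable_sq z), ?_⟩) hB
  · have := integral_map (μ := S.P) (S.measurable_sample (l j)).aemeasurable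
      (f := fun ξ => g z ξ - gradient f z) he.aestronglyMeasurable
    rw [← this, S.law_sample, integral_sub (hg.integrable z) (integrable_const _), hg.unbiased]
    simp
  · have := integral_map (μ := S.P) (S.measurable_sample (l j)).aemeasurable
      (f := fun ξ => ‖g z ξ - gradient f z‖ ^ 2) (he.norm.pow_const 2).aestronglyMeasurable
    rw [← this, S.law_sample]
    exact hg.variance_le z

/-- The labels of the samples drawn before inner iteration `k` of outer iteration `t`. -/
def pastLabels (t k : ℕ) : Set Label := {l | l.1 < t ∨ l.1 = t ∧ l.2.1 < k}

/-- The information contained in the samples with labels in a given set. -/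
abbrev info (A : Set Label) : MeasurableSpace S.Ω := ⨆ l ∈ A, S.mΞ.comap (S.sample l)

theorem info_le (A : Set Label) : S.info A ≤ S.mΩ :=
  iSup₂_le fun l _ => (S.measurable_sample l).comap_le

theorem info_mono {A A' : Set Label} (h : A ⊆ A') : S.info A ≤ S.info A' :=
  biSup_mono h

theorem measurable_sample_info {A : Set Label} {l : Label} (hl : l ∈ A) :
    Measurable[S.info A] (S.sample l) :=
  measurable_iff_comap_le.2 (le_biSup (fun l => S.mΞ.comap (S.sample l)) hl)

/-- The minibatch of fresh samples at a point that depends on other samples. -/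
theorem meanLE_minibatch {f : Joint m n → ℝ} {g : Joint m n → S.Ξ → Joint m n} {s : ℝ}
    (hg : IsStochGradient S.D f g s) {B : ℕ} (hB : 1 ≤ B) {t k : ℕ} (i : Fin 3)
    {Z : S.Ω → Joint m n} (hZ : Measurable[S.info (pastLabels t k)] Z) :
    MeanLE S.P (fun ω => ‖minibatch g B (Z ω) (fun j => S.sample (t, k, i, j) ω) -
      gradient f (Z ω)‖ ^ 2) (s ^ 2 / B) := by
  have hV : ∀ A : Set Label, (∀ j, (t, k, i, j) ∈ A) →
      Measurable[S.info A] fun ω j => S.sample (t, k, i, j) ω := fun A hA =>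
    @measurable_pi_lambda _ _ _ (S.info A) _ _ fun j => S.measurable_sample_info (hA j)
  have hind : IndepFun Z (fun ω j => S.sample (t, k, i, j) ω) S.P := by
    rw [IndepFun_iff_Indep]
    -- Past labels at outer index `t` have inner index strictly below `k`, so every sample labelled
    -- `(t, k, ·, ·)` is fresh.
    have hdisj : Disjoint (pastLabels t k) {l | l.1 = t ∧ l.2.1 = k} := by
      rw [Set.disjoint_left]
      rintro l (h | ⟨_, h⟩) ⟨h1, h2⟩ <;> omega
    exact indep_of_indep_of_le_left (indep_of_indep_of_le_right
      (indep_iSup_of_disjoint (fun l => (S.measurable_sample l).comap_le) S.indep_sample.iIndep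
        hdisj) (hV {l | l.1 = t ∧ l.2.1 = k} fun j => ⟨rfl, rfl⟩).comap_le) hZ.comap_le
  have hmeas : Measurable fun p : Joint m n × (ℕ → S.Ξ) =>
      ‖minibatch g B p.1 p.2 - gradient f p.1‖ ^ 2 :=
    ((measurable_minibatch hg.measurable B).sub
      ((measurable_gradient f).comp measurable_fst)).norm.pow_const 2
  exact MeanLE.of_indepFun (hZ.mono (S.info_le _) le_rfl)
    ((hV Set.univ fun _ => trivial).mono (S.info_le _) le_rfl) hind hmeas (fun _ => by positivity)
    (by positivity) fun z => S.meanLE_minibatch_fixed hg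
      (l := fun j => (t, k, i, j)) (fun j j' h => by simpa using h) hB z

end SamplingModel

end Minibatch

/-! ### Runs with inexact gradients: inner contraction, gap recursion, outer descent -/

section InexactRuns

variable {m n : ℕ}

theorem sq_norm_le_two_mul {E : Type*} [SeminormedAddCommGroup E] (a b : E) :
    ‖a‖ ^ 2 ≤ 2 * ‖a - b‖ ^ 2 + 2 * ‖b‖ ^ 2 := by
  have h : ‖a‖ ≤ ‖a - b‖ + ‖b‖ := by simpa using norm_add_le (a - b) b
  nlinarith [norm_nonneg a, sq_nonneg (‖a - b‖ - ‖b‖)]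

/-- Danskin's theorem makes the uncountable supremum differentiable in `φ`, hence measurable. -/
theorem PLSmooth.measurable_gap {f : Joint m n → ℝ} {L : ℝ≥0} {μ : ℝ} (hf : PLSmooth f L μ)
    {Ω : Type*} [MeasurableSpace Ω] {φ : Ω → EuclideanSpace ℝ (Fin m)}
    {y : Ω → EuclideanSpace ℝ (Fin n)} (hφ : Measurable φ) (hy : Measurable y) :
    Measurable fun ω => gap f (φ ω) (y ω) := by
  have hdiff : Differentiable ℝ (maxVal f) := fun φ => by
    obtain ⟨y, hy⟩ := hf.exists_mem φ
    exact (hf.hasGradientAt_maxVal hy).differentiableAt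
  exact (hdiff.continuous.measurable.comp hφ).sub
    (hf.diff.continuous.measurable.comp (measurable_pt.comp (hφ.prodMk hy)))

/-- Inexact gradient ascent on a PL function converges geometrically, up to the error. -/
theorem PLSmooth.meanLE_gap_ascent {f : Joint m n → ℝ} {L : ℝ≥0} {μ : ℝ} (hf : PLSmooth f L μ)
    {Ω : Type*} [MeasurableSpace Ω] {P : Measure Ω} {φ : Ω → EuclideanSpace ℝ (Fin m)}
    {y d : ℕ → Ω → EuclideanSpace ℝ (Fin n)} {τ : ℕ → ℝ} {τmin v a : ℝ} (hτmin : 0 < τmin)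
    (hτ : ∀ k, τmin ≤ τ k ∧ τ k ≤ 1 / L) (hφ : Measurable φ) (hy : ∀ k, Measurable (y k))
    (hstep : ∀ k ω, y (k + 1) ω = y k ω + τ k • d k ω) (hv : 0 ≤ v)
    (herr : ∀ k, MeanLE P
      (fun ω => ‖d k ω - lower (gradient f (pt (φ ω) (y k ω)))‖ ^ 2) v)
    (h0 : MeanLE P (fun ω => gap f (φ ω) (y 0 ω)) a) (k : ℕ) :
    MeanLE P (fun ω => gap f (φ ω) (y k ω))
      (Real.exp (-(τmin * μ / 2)) ^ k * a + 1 / L / (1 - Real.exp (-(τmin * μ / 2))) * v) := by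
  have hμ := hf.mu_pos
  set ρ := Real.exp (-(τmin * μ / 2)) with hρ
  have hρ1 : ρ < 1 := Real.exp_lt_one_iff.2 (by rw [neg_lt_zero]; positivity)
  -- Weakening `1 - x` to `exp (-x)` keeps the factor positive and yields the form `e^{-cK}`
  -- directly.
  have hρ' : 1 - τmin * μ / 2 ≤ ρ := by
    have := Real.add_one_le_exp (-(τmin * μ / 2))
    linarith
  have hL : (0 : ℝ) ≤ 1 / L := by positivity
  have h1ρ : 0 < 1 - ρ := by linarith
  induction k with
  | zero =>
    refine h0.le ?_
    have : 0 ≤ 1 / (L : ℝ) / (1 - ρ) * v := by positivity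
    linarith
  | succ k ih =>
    -- The error weight `τ/2` is at most `1/L`, and `(1/L)/(1-ρ)` is the fixed point of `x ↦ ρx +
    -- 1/L`.
    have hb := ((ih.const_mul (c := ρ) (Real.exp_pos _).le).add ((herr k).const_mul hL))
    refine (hb.mono (hf.measurable_gap hφ (hy (k + 1))) (fun ω => hf.gap_nonneg _ _)
      fun ω => ?_).le (le_of_eq ?_)
    · obtain ⟨h1, h2⟩ := hτ k
      have hτ0 : 0 ≤ τ k := hτmin.le.trans h1
      have hτL : τ k * L ≤ 1 := by
        refine (mul_le_mul_of_nonneg_right h2 L.2).trans ?_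
        rw [one_div]
        exact inv_mul_le_one
      rw [hstep]
      refine (hf.gap_step hτ0 hτL _ _ _).trans (add_le_add ?_ ?_)
      · refine mul_le_mul_of_nonneg_right ?_ (hf.gap_nonneg _ _)
        have := mul_le_mul_of_nonneg_right h1 hμ.le
        linarith
      · exact mul_le_mul_of_nonneg_right (by linarith) (sq_nonneg _)
    · field_simp
      ring

/-- A run of the bilevel algorithm with inexact gradients: `d`, `d'` are the directions of the
inner loops, `e` is the hypergradient estimate, and `v` bounds the mean squared errors. -/
structure InexactRun (J G : Joint m n → ℝ) {Ω : Type*} [MeasurableSpace Ω] (P : Measure Ω)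
    (K : ℕ) (σ η v : ℝ) (τ τ' : ℕ → ℝ) (s₀ : State m n) where
  φ : ℕ → Ω → EuclideanSpace ℝ (Fin m)
  y : ℕ → ℕ → Ω → EuclideanSpace ℝ (Fin n)
  y' : ℕ → ℕ → Ω → EuclideanSpace ℝ (Fin n)
  d : ℕ → ℕ → Ω → EuclideanSpace ℝ (Fin n)
  d' : ℕ → ℕ → Ω → EuclideanSpace ℝ (Fin n)
  e : ℕ → Ω → EuclideanSpace ℝ (Fin m)
  measurable_φ : ∀ t, Measurable (φ t)
  measurable_y : ∀ t k, Measurable (y t k)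
  measurable_y' : ∀ t k, Measurable (y' t k)
  measurable_e : ∀ t, Measurable (e t)
  φ_zero : ∀ ω, φ 0 ω = s₀.φ
  y_zero : ∀ ω, y 0 0 ω = s₀.y
  y'_zero : ∀ ω, y' 0 0 ω = s₀.y'
  φ_step : ∀ t ω, φ (t + 1) ω = φ t ω - η • e t ω
  y_step : ∀ t k ω, y t (k + 1) ω = y t k ω + τ k • d t k ω
  y'_step : ∀ t k ω, y' t (k + 1) ω = y' t k ω + τ' k • d' t k ω
  y_next : ∀ t ω, y (t + 1) 0 ω = y t K ω
  y'_next : ∀ t ω, y' (t + 1) 0 ω = y' t K ω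
  d_err : ∀ t k, MeanLE P
    (fun ω => ‖d t k ω - lower (gradient J (pt (φ t ω) (y t k ω)))‖ ^ 2) v
  d'_err : ∀ t k, MeanLE P
    (fun ω => ‖d' t k ω - lower (gradient (penalty J G σ) (pt (φ t ω) (y' t k ω)))‖ ^ 2) v
  e_err : ∀ t, MeanLE P
    (fun ω => ‖e t ω - (1 / σ) • (upper (gradient J (pt (φ t ω) (y t K ω))) -
      upper (gradient (penalty J G σ) (pt (φ t ω) (y' t K ω))))‖ ^ 2) (v / σ ^ 2)

namespace Regular

variable {J G : Joint m n → ℝ} {σ₀ μ : ℝ} {LJ Lh LH LG : ℝ≥0}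
  (hreg : Regular J G σ₀ μ LJ Lh LH LG)
include hreg

/-- The bias of the hypergradient estimate is controlled by the lower-level gaps. -/
theorem exists_bias_bound : ∃ C : ℝ, 0 ≤ C ∧ ∀ σ : ℝ, 0 < σ → σ ≤ σ₀ →
    ∀ (φ e : EuclideanSpace ℝ (Fin m)) (y y' : EuclideanSpace ℝ (Fin n)),
      ‖e - gradient (proxyObjective J G σ) φ‖ ^ 2 ≤
        2 * ‖e - (1 / σ) • (upper (gradient J (pt φ y)) -
          upper (gradient (penalty J G σ) (pt φ y')))‖ ^ 2 +
        C / σ ^ 2 * (gap J φ y + gap (penalty J G σ) φ y') := by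
  set KJ : ℝ := (LJ * errConst LJ μ) ^ 2 * (2 * (LJ + 1)) with hKJ
  set Kh : ℝ := (Lh * errConst Lh μ) ^ 2 * (2 * (Lh + 1)) with hKh
  have hKJ0 : 0 ≤ KJ := by positivity
  have hKh0 : 0 ≤ Kh := by positivity
  refine ⟨4 * (KJ + Kh), by positivity, fun σ h0 h1 φ e y y' => ?_⟩
  have hh := hreg.plSmooth h0.le h1
  obtain ⟨w, hw⟩ := hreg.plSmooth_J.exists_mem φ
  obtain ⟨w', hw'⟩ := hh.exists_mem φ
  have e1 := hreg.plSmooth_J.norm_upper_gradient_sub_sq_le hw y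
  have e2 := hh.norm_upper_gradient_sub_sq_le hw' y'
  have g1 := hreg.plSmooth_J.gap_nonneg φ y
  have g2 := hh.gap_nonneg φ y'
  rw [hreg.gradient_proxyObjective h0 h1 hw hw']
  set a := upper (gradient J (pt φ y))
  set b := upper (gradient (penalty J G σ) (pt φ y'))
  set a₀ := upper (gradient J (pt φ w))
  set b₀ := upper (gradient (penalty J G σ) (pt φ w'))
  -- Sampling error plus bias, where `a₀`, `b₀` are the upper gradients at exact maximisers.
  -- Squaring the prefactor produces `1/σ²`.
  have h2 := sq_norm_le_two_mul (e - (1 / σ) • (a₀ - b₀)) ((1 / σ) • (a - b) - (1 / σ) • (a₀ - b₀))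
  rw [sub_sub_sub_cancel_right, ← smul_sub, norm_smul, Real.norm_of_nonneg (by positivity),
    mul_pow] at h2
  refine h2.trans (add_le_add le_rfl ?_)
  have h3 := sq_norm_le_two_mul (a - b - (a₀ - b₀)) (-(b - b₀))
  rw [show a - b - (a₀ - b₀) - -(b - b₀) = a - a₀ by abel, norm_neg] at h3
  have h4 : ‖a - b - (a₀ - b₀)‖ ^ 2 ≤
      2 * (KJ + Kh) * (gap J φ y + gap (penalty J G σ) φ y') := by
    nlinarith [mul_nonneg hKJ0 g2, mul_nonneg hKh0 g1]
  calc _ ≤ 2 * ((1 / σ) ^ 2 * (2 * (KJ + Kh) * (gap J φ y + gap (penalty J G σ) φ y'))) := by gcongr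
    _ = _ := by ring

end Regular

namespace InexactRun

variable {J G : Joint m n → ℝ} {σ₀ μ : ℝ} {LJ Lh LH LG : ℝ≥0}
  {Ω : Type*} [MeasurableSpace Ω] {P : Measure Ω} {K : ℕ} {σ η v : ℝ} {τ τ' : ℕ → ℝ}
  {s₀ : State m n} (R : InexactRun J G P K σ η v τ τ' s₀)

/-- The squared error of the hypergradient estimate as an estimate of the proxy gradient. -/
def errSq (t : ℕ) (ω : Ω) : ℝ := ‖R.e t ω - gradient (proxyObjective J G σ) (R.φ t ω)‖ ^ 2

theorem measurable_errSq (t : ℕ) : Measurable (R.errSq t) :=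
  (((R.measurable_e t).sub
    ((measurable_gradient (proxyObjective J G σ)).comp (R.measurable_φ t))).norm).pow_const 2

theorem meanLE_errSq {C s : ℝ} (hC : 0 ≤ C)
    (hbias : ∀ (φ e : EuclideanSpace ℝ (Fin m)) (y y' : EuclideanSpace ℝ (Fin n)),
      ‖e - gradient (proxyObjective J G σ) φ‖ ^ 2 ≤
        2 * ‖e - (1 / σ) • (upper (gradient J (pt φ y)) -
          upper (gradient (penalty J G σ) (pt φ y')))‖ ^ 2 +
        C / σ ^ 2 * (gap J φ y + gap (penalty J G σ) φ y')) {t : ℕ}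
    (h : MeanLE P (fun ω => gap J (R.φ t ω) (R.y t K ω)) s)
    (h' : MeanLE P (fun ω => gap (penalty J G σ) (R.φ t ω) (R.y' t K ω)) s) :
    MeanLE P (R.errSq t) ((2 * v + 2 * C * s) / σ ^ 2) := by
  have hb := ((R.e_err t).const_mul zero_le_two).add ((h.add h').const_mul
    (c := C / σ ^ 2) (by positivity))
  refine (hb.mono (R.measurable_errSq t) (fun ω => sq_nonneg _)
    fun ω => hbias _ _ _ _).le (le_of_eq ?_)
  ring

/-- Uniform bound of the lower-level gaps when the inner loops are long enough. -/
theorem meanLE_gaps [IsProbabilityMeasure P] (hreg : Regular J G σ₀ μ LJ Lh LH LG)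
    (h0 : 0 < σ) (h1 : σ ≤ σ₀) {τmin : ℝ} (hτmin : 0 < τmin)
    (hτ : ∀ k, τmin ≤ τ k ∧ τ k ≤ 1 / LJ) (hτ' : ∀ k, τmin ≤ τ' k ∧ τ' k ≤ 1 / Lh)
    (hv : 0 ≤ v) {C Λ c M g b A ρ : ℝ} (hC : 0 ≤ C)
    (hbias : ∀ (φ e : EuclideanSpace ℝ (Fin m)) (y y' : EuclideanSpace ℝ (Fin n)),
      ‖e - gradient (proxyObjective J G σ) φ‖ ^ 2 ≤
        2 * ‖e - (1 / σ) • (upper (gradient J (pt φ y)) -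
          upper (gradient (penalty J G σ) (pt φ y')))‖ ^ 2 +
        C / σ ^ 2 * (gap J φ y + gap (penalty J G σ) φ y'))
    (hM : ∀ φ, ‖gradient (proxyObjective J G σ) φ‖ ≤ M)
    (hΛJ : 4 * (LJ + 1) / μ ≤ Λ) (hΛh : 4 * (Lh + 1) / μ ≤ Λ)
    (hcJ : 2 * LJ ^ 2 / μ ≤ c) (hch : 2 * Lh ^ 2 / μ ≤ c)
    (hgJ : gap J s₀.φ s₀.y ≤ g) (hgh : gap (penalty J G σ) s₀.φ s₀.y' ≤ g)
    (hρ : ρ = Real.exp (-(τmin * μ / 2)))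
    (hbJ : 1 / LJ / (1 - ρ) ≤ b) (hbh : 1 / Lh / (1 - ρ) ≤ b)
    (hA : A = Λ * σ₀ ^ 2 + 4 * (c * η ^ 2) * C) (hK : ρ ^ K * A ≤ σ ^ 2 / 2) (t : ℕ) :
    MeanLE P (fun ω => gap J (R.φ t ω) (R.y t K ω))
        (ρ ^ K * (g + 4 * (c * η ^ 2) * M ^ 2) + v * (4 * (c * η ^ 2) / A + 2 * b)) ∧
      MeanLE P (fun ω => gap (penalty J G σ) (R.φ t ω) (R.y' t K ω))
        (ρ ^ K * (g + 4 * (c * η ^ 2) * M ^ 2) + v * (4 * (c * η ^ 2) / A + 2 * b)) := by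
  have hμ := hreg.mu_pos
  have hσ₀ := hreg.sigma_pos
  have hJ := hreg.plSmooth_J
  have hh := hreg.plSmooth h0.le h1
  have hLJ : (0 : ℝ) ≤ LJ := LJ.2
  have hΛ : 0 < Λ := lt_of_lt_of_le (by positivity) hΛJ
  have hc : 0 ≤ c := le_trans (by positivity) hcJ
  have hg : 0 ≤ g := (hJ.gap_nonneg _ _).trans hgJ
  have hρ0 : 0 < ρ := hρ ▸ Real.exp_pos _
  have hρ1 : ρ < 1 := hρ ▸ Real.exp_lt_one_iff.2 (by rw [neg_lt_zero]; positivity)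
  have h1ρ : 0 < 1 - ρ := by linarith
  have hb : 0 ≤ b := le_trans (by positivity) hbJ
  set w := c * η ^ 2 with hw
  have hw0 : 0 ≤ w := by positivity
  have hA0 : 0 < A := by rw [hA]; positivity
  set p := ρ ^ K with hp
  have hp0 : 0 < p := pow_pos hρ0 K
  -- The movement and noise terms are twice what one outer iteration adds; the spare half of `s`
  -- absorbs the gap carried over by the warm start.
  set s := p * (g + 4 * w * M ^ 2) + v * (4 * w / A + 2 * b) with hs
  have hs0 : 0 ≤ s := by positivity
  have inner : ∀ t a, 0 ≤ a → p * a + b * v ≤ s →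
      MeanLE P (fun ω => gap J (R.φ t ω) (R.y t 0 ω)) a →
      MeanLE P (fun ω => gap (penalty J G σ) (R.φ t ω) (R.y' t 0 ω)) a →
      MeanLE P (fun ω => gap J (R.φ t ω) (R.y t K ω)) s ∧
        MeanLE P (fun ω => gap (penalty J G σ) (R.φ t ω) (R.y' t K ω)) s := by
    intro t a ha hle ha1 ha2
    constructor
    · refine (hJ.meanLE_gap_ascent hτmin hτ (R.measurable_φ t) (R.measurable_y t) (R.y_step t) hv
        (R.d_err t) ha1 K).le ?_
      rw [← hρ]
      exact le_trans (by gcongr) hle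
    · refine (hh.meanLE_gap_ascent hτmin hτ' (R.measurable_φ t) (R.measurable_y' t) (R.y'_step t) hv
        (R.d'_err t) ha2 K).le ?_
      rw [← hρ]
      exact le_trans (by gcongr) hle
  induction t with
  | zero =>
    refine inner 0 g hg ?_ ?_ ?_
    · have : 0 ≤ p * (4 * w * M ^ 2) + v * (4 * w / A + b) := by positivity
      rw [hs]
      linarith
    · simp only [R.φ_zero, R.y_zero]
      exact (MeanLE.const _).le hgJ
    · simp only [R.φ_zero, R.y'_zero]
      exact (MeanLE.const _).le hgh
  | succ t ih =>
    have hE := R.meanLE_errSq hC hbias ih.1 ih.2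
    have hD : MeanLE P (fun ω => ‖R.φ (t + 1) ω - R.φ t ω‖ ^ 2)
        (η ^ 2 * (2 * ((2 * v + 2 * C * s) / σ ^ 2) + 2 * M ^ 2)) := by
      refine (((hE.const_mul zero_le_two).add (MeanLE.const (2 * M ^ 2))).const_mul
        (sq_nonneg η)).mono (((R.measurable_φ _).sub (R.measurable_φ _)).norm.pow_const 2)
        (fun ω => sq_nonneg _) fun ω => ?_
      have e1 := sq_norm_le_two_mul (R.e t ω) (gradient (proxyObjective J G σ) (R.φ t ω))
      have e2 : ‖gradient (proxyObjective J G σ) (R.φ t ω)‖ ^ 2 ≤ M ^ 2 :=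
        pow_le_pow_left₀ (norm_nonneg _) (hM _) 2
      rw [R.φ_step, sub_sub_cancel_left, norm_neg, norm_smul, mul_pow, Real.norm_eq_abs, sq_abs]
      refine mul_le_mul_of_nonneg_left ?_ (sq_nonneg η)
      unfold errSq
      linarith
    refine inner (t + 1)
      (Λ * s + c * (η ^ 2 * (2 * ((2 * v + 2 * C * s) / σ ^ 2) + 2 * M ^ 2)))
      (by positivity) ?_ ?_ ?_
    -- `A` collects the two feedbacks of `s` into the next gap: `Λσ₀²` for the change of `φ` and
    -- `4wC` for the gap-induced part of the move itself. Since `qA ≤ 1/2`, together they return at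
    -- most `s/2`.
    · set q := p / σ ^ 2 with hq
      have hpq : p = q * σ ^ 2 := by rw [hq]; field_simp
      have hq0 : 0 < q := by positivity
      have hqA : q * A ≤ 1 / 2 := by
        rw [hq, div_mul_eq_mul_div, div_le_iff₀ (by positivity)]
        linarith
      have e1 : p * Λ * s ≤ q * (Λ * σ₀ ^ 2) * s := by
        rw [hpq]
        have : q * σ ^ 2 * Λ ≤ q * σ₀ ^ 2 * Λ := by gcongr
        nlinarith
      have e2 : q * A * s ≤ 1 / 2 * s := by gcongr
      have e3 : q * (4 * w * v) ≤ 2 * w / A * v := by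
        have : q ≤ 1 / (2 * A) := by
          rw [le_div_iff₀ (by positivity)]
          linarith
        calc q * (4 * w * v) ≤ 1 / (2 * A) * (4 * w * v) := by gcongr
          _ = _ := by field_simp; norm_num
      have e4 : p * (Λ * s + c * (η ^ 2 * (2 * ((2 * v + 2 * C * s) / σ ^ 2) + 2 * M ^ 2))) =
          p * Λ * s + q * (4 * w * v) + q * (4 * w * C) * s + 2 * w * M ^ 2 * p := by
        rw [hq, hw]
        field_simp
        ring
      have e5 : q * A * s = q * (Λ * σ₀ ^ 2) * s + q * (4 * w * C) * s := by rw [hA]; ring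
      have e6 : s = p * g + 4 * w * M ^ 2 * p + 2 * (2 * w / A * v) + 2 * (b * v) := by
        rw [hs]; ring
      have e7 : 0 ≤ p * g := by positivity
      rw [e4]
      linarith
    · refine ((ih.1.const_mul hΛ.le).add (hD.const_mul hc)).mono
        (hJ.measurable_gap (R.measurable_φ _) (R.measurable_y _ _))
        (fun ω => hJ.gap_nonneg _ _) fun ω => ?_
      rw [R.y_next]
      refine (hJ.gap_le_of_move (R.φ t ω) _ _).trans (add_le_add ?_ ?_)
      · exact mul_le_mul_of_nonneg_right hΛJ (hJ.gap_nonneg _ _)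
      · exact mul_le_mul_of_nonneg_right hcJ (sq_nonneg _)
    · refine ((ih.2.const_mul hΛ.le).add (hD.const_mul hc)).mono
        (hh.measurable_gap (R.measurable_φ _) (R.measurable_y' _ _))
        (fun ω => hh.gap_nonneg _ _) fun ω => ?_
      rw [R.y'_next]
      refine (hh.gap_le_of_move (R.φ t ω) _ _).trans (add_le_add ?_ ?_)
      · exact mul_le_mul_of_nonneg_right hΛh (hh.gap_nonneg _ _)
      · exact mul_le_mul_of_nonneg_right hch (sq_nonneg _)

/-- Inexact gradient descent on the proxy objective, along one realisation. -/
theorem sum_norm_gradient_sq_le {L : ℝ≥0} (hd : Differentiable ℝ (proxyObjective J G σ))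
    (hL : LipschitzWith L (fun φ => gradient (proxyObjective J G σ) φ)) (hη : 0 < η)
    (hηL : η * L ≤ 1) (ω : Ω) (N : ℕ) :
    ∑ t ∈ Finset.range N, ‖gradient (proxyObjective J G σ) (R.φ t ω)‖ ^ 2 ≤
      2 / η * (proxyObjective J G σ (R.φ 0 ω) - proxyObjective J G σ (R.φ N ω)) +
        ∑ t ∈ Finset.range N, R.errSq t ω := by
  induction N with
  | zero => simp
  | succ N ih =>
    rw [Finset.sum_range_succ, Finset.sum_range_succ]
    have h1 := (abs_le.1 (abs_sub_inner_gradient_le hd hL (R.φ N ω) (-(η • R.e N ω)))).2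
    rw [← sub_eq_add_neg, ← R.φ_step, inner_neg_right, inner_smul_right, norm_neg, norm_smul,
      Real.norm_of_nonneg hη.le] at h1
    have h2 := norm_sub_sq_real (R.e N ω) (gradient (proxyObjective J G σ) (R.φ N ω))
    rw [real_inner_comm] at h2
    -- As in `PLSmooth.gap_step`, the square of the inexact direction enters with a favourable sign.
    have h3 : 0 ≤ η * (1 - η * L) * ‖R.e N ω‖ ^ 2 :=
      mul_nonneg (mul_nonneg hη.le (by linarith)) (sq_nonneg _)
    have h4 : ‖gradient (proxyObjective J G σ) (R.φ N ω)‖ ^ 2 ≤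
        2 / η * (proxyObjective J G σ (R.φ N ω) - proxyObjective J G σ (R.φ (N + 1) ω)) +
          R.errSq N ω := by
      unfold errSq
      rw [h2, div_mul_eq_mul_div, ← sub_le_iff_le_add, le_div_iff₀ hη]
      nlinarith
    have h5 : 2 / η * (proxyObjective J G σ (R.φ 0 ω) - proxyObjective J G σ (R.φ (N + 1) ω)) =
        2 / η * (proxyObjective J G σ (R.φ 0 ω) - proxyObjective J G σ (R.φ N ω)) +
        2 / η * (proxyObjective J G σ (R.φ N ω) - proxyObjective J G σ (R.φ (N + 1) ω)) := by ring
    rw [h5]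
    linarith

end InexactRun

end InexactRuns

/-! ### Convergence rate for inexact runs -/

section Convergence

variable {m n : ℕ}

/-- Descent sums `T + 1` terms while the average has `T`; this costs a factor `(T+1)/T ≤ 2`. The
slack `r` makes room for the constant of the short-inner-loop case. -/
theorem average_le {T : ℕ} {η D C₁ C₅ r X Y z : ℝ} (hT : 1 ≤ T) (hη : 0 < η)
    (hD : 0 ≤ 4 / η * D) (hXY : 0 ≤ X + Y) (hC₅ : 0 ≤ C₅) (hz : 0 ≤ z ^ 2) (hr : 0 ≤ r) :
    1 / (T : ℝ) * (2 * (2 / η * D + ((T + 1 : ℕ) : ℝ) * (C₅ * (X + Y))) +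
      T * (2 * (C₁ * z) ^ 2)) ≤
    (4 / η * D + 4 * C₅ + 2 * C₁ ^ 2 + r) * (1 / (T : ℝ) + X + Y + z ^ 2) := by
  have hT1 : (1 : ℝ) ≤ T := by exact_mod_cast hT
  have hx : 0 ≤ 1 / (T : ℝ) := by positivity
  have hx1 : 1 / (T : ℝ) ≤ 1 := by
    rw [div_le_one (by linarith)]
    exact hT1
  have hW : 0 ≤ C₅ * (X + Y) := mul_nonneg hC₅ hXY
  have e1 : 1 / (T : ℝ) * (2 * (2 / η * D + ((T + 1 : ℕ) : ℝ) * (C₅ * (X + Y))) +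
      T * (2 * (C₁ * z) ^ 2)) =
      4 / η * D * (1 / T) + 2 * (C₅ * (X + Y)) + 2 * (C₅ * (X + Y)) * (1 / T) +
        2 * C₁ ^ 2 * z ^ 2 := by
    push_cast
    field_simp
    ring
  have e2 : 2 * (C₅ * (X + Y)) * (1 / T) ≤ 2 * (C₅ * (X + Y)) :=
    mul_le_of_le_one_right (by positivity) hx1
  rw [e1]
  have e3 : 4 / η * D * (1 / T) ≤ 4 / η * D * (1 / (T : ℝ) + X + Y + z ^ 2) :=
    mul_le_mul_of_nonneg_left (by linarith) hD
  have e4 : C₅ * (X + Y) ≤ C₅ * (1 / (T : ℝ) + X + Y + z ^ 2) :=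
    mul_le_mul_of_nonneg_left (by linarith) hC₅
  have e5 : 2 * C₁ ^ 2 * z ^ 2 ≤ 2 * C₁ ^ 2 * (1 / (T : ℝ) + X + Y + z ^ 2) :=
    mul_le_mul_of_nonneg_left (by linarith) (by positivity)
  have e6 : 0 ≤ r * (1 / (T : ℝ) + X + Y + z ^ 2) := mul_nonneg hr (by linarith)
  linarith

namespace Regular

variable {J G : Joint m n → ℝ} {σ₀ μ : ℝ} {LJ Lh LH LG : ℝ≥0}
  (hreg : Regular J G σ₀ μ LJ Lh LH LG)
include hreg

/-- The initial gaps are bounded uniformly in `σ`. -/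
theorem exists_gap_bound (s₀ : State m n) : ∃ g : ℝ, gap J s₀.φ s₀.y ≤ g ∧
    ∀ σ : ℝ, 0 ≤ σ → σ ≤ σ₀ → gap (penalty J G σ) s₀.φ s₀.y' ≤ g := by
  have hμ := hreg.mu_pos
  set a := (‖gradient J (pt s₀.φ s₀.y')‖ + σ₀ * ‖gradient G (pt s₀.φ s₀.y')‖) ^ 2 / μ with ha
  refine ⟨max (gap J s₀.φ s₀.y) a, le_max_left _ _, fun σ h0 h1 => le_max_of_le_right ?_⟩
  have h := (hreg.plSmooth h0 h1).mul_gap_le s₀.φ s₀.y'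
  rw [ha, le_div_iff₀ hμ, mul_comm]
  refine h.trans (pow_le_pow_left₀ (norm_nonneg _) ((norm_lower_le _).trans ?_) 2)
  rw [hreg.gradient_penalty]
  refine (norm_sub_le _ _).trans (add_le_add le_rfl ?_)
  rw [norm_smul, Real.norm_of_nonneg h0]
  gcongr

theorem exists_norm_gradient_hyperObjective_le :
    ∃ M : ℝ, ∀ φ, ‖gradient (hyperObjective J G) φ‖ ≤ M := by
  obtain ⟨C, _, hC⟩ := hreg.exists_norm_gradient_sub_le
  refine ⟨C * σ₀ + (Lh * (errConst Lh μ * LG) + LG), fun φ => ?_⟩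
  have h1 := hC φ σ₀ hreg.sigma_pos le_rfl
  have h2 := hreg.norm_gradient_proxyObjective_le hreg.sigma_pos le_rfl φ
  rw [norm_sub_rev] at h1
  have h3 := norm_le_norm_add_norm_sub' (gradient (hyperObjective J G) φ)
    (gradient (proxyObjective J G σ₀) φ)
  linarith

theorem exists_proxyObjective_decrease_le (hbdd : BddBelow (Set.range (hyperObjective J G)))
    (φ₀ : EuclideanSpace ℝ (Fin m)) : ∃ D : ℝ, 0 ≤ D ∧ ∀ σ : ℝ, 0 < σ → σ ≤ σ₀ →
      ∀ φ, proxyObjective J G σ φ₀ - proxyObjective J G σ φ ≤ D := by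
  obtain ⟨l, hl⟩ := hbdd
  have hκ := errConst_nonneg (L := Lh) hreg.mu_pos
  have h0 := hl ⟨φ₀, rfl⟩
  have hσ₀ := hreg.sigma_pos
  have h2 : 0 ≤ LG * (errConst Lh μ * LG) * σ₀ := by positivity
  refine ⟨hyperObjective J G φ₀ - l + LG * (errConst Lh μ * LG) * σ₀, by linarith,
    fun σ hs hs' φ => ?_⟩
  have h3 := hreg.proxyObjective_le hs hs' φ₀
  have h4 := hreg.hyperObjective_le hs hs' φ
  have h5 := hl ⟨φ, rfl⟩
  have h6 : LG * (errConst Lh μ * LG) * σ ≤ LG * (errConst Lh μ * LG) * σ₀ := by gcongr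
  linarith

set_option maxHeartbeats 1000000 in
/-- Convergence of the bilevel algorithm with inexact gradients. -/
theorem exists_avg_bound (hbdd : BddBelow (Set.range (hyperObjective J G))) (s₀ : State m n)
    {L : ℝ≥0} (hL : ProxySmooth J G σ₀ L) {η : ℝ} (hη : 0 < η) (hηL : η ≤ 1 / (2 * (L : ℝ)))
    {τmin : ℝ} (hτmin : 0 < τmin) : ∃ C c : ℝ, 0 < C ∧ 0 < c ∧
    ∀ {Ω : Type v} [MeasurableSpace Ω] (P : Measure Ω) [IsProbabilityMeasure P] (σ : ℝ) (T K : ℕ)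
      (w : ℝ) (τ τ' : ℕ → ℝ) (R : InexactRun J G P K σ η w τ τ' s₀),
      (∀ k, τmin ≤ τ k ∧ τ k ≤ 1 / (LJ : ℝ)) → (∀ k, τmin ≤ τ' k ∧ τ' k ≤ 1 / (Lh : ℝ)) →
      0 ≤ w → 0 < σ → σ ≤ σ₀ → 1 ≤ T →
      (∀ t, Integrable (fun ω => ‖gradient (hyperObjective J G) (R.φ t ω)‖ ^ 2) P) ∧
      (1 / (T : ℝ)) * ∑ t ∈ Finset.Icc 1 T,
        ∫ ω, ‖gradient (hyperObjective J G) (R.φ t ω)‖ ^ 2 ∂P ≤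
        C * (1 / (T : ℝ) + Real.exp (-(c * (K : ℝ))) / σ ^ 2 + w / σ ^ 2 + σ ^ 2) := by
  have hμ := hreg.mu_pos
  have hσ₀ := hreg.sigma_pos
  obtain ⟨C₁, hC₁, happrox⟩ := hreg.exists_norm_gradient_sub_le
  obtain ⟨M', hM'⟩ := hreg.exists_norm_gradient_hyperObjective_le
  obtain ⟨D, hD, hdec⟩ := hreg.exists_proxyObjective_decrease_le hbdd s₀.φ
  obtain ⟨C₃, hC₃, hbias⟩ := hreg.exists_bias_bound
  obtain ⟨g, hgJ, hgh⟩ := hreg.exists_gap_bound s₀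
  have hg : 0 ≤ g := (hreg.plSmooth_J.gap_nonneg _ _).trans hgJ
  have hLJ : (0 : ℝ) ≤ LJ := LJ.2
  have hLh : (0 : ℝ) ≤ Lh := Lh.2
  set M : ℝ := Lh * (errConst Lh μ * LG) + LG
  obtain ⟨Λ, hΛ⟩ : ∃ r : ℝ, r = 4 * (LJ + 1) / μ + 4 * (Lh + 1) / μ := ⟨_, rfl⟩
  obtain ⟨c₂, hc₂⟩ : ∃ r : ℝ, r = 2 * LJ ^ 2 / μ + 2 * Lh ^ 2 / μ := ⟨_, rfl⟩
  set ρ := Real.exp (-(τmin * μ / 2)) with hρ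
  have hρ1 : ρ < 1 := Real.exp_lt_one_iff.2 (by rw [neg_lt_zero]; positivity)
  have h1ρ : 0 < 1 - ρ := by linarith
  obtain ⟨b, hb⟩ : ∃ r : ℝ, r = 1 / LJ / (1 - ρ) + 1 / Lh / (1 - ρ) := ⟨_, rfl⟩
  have hΛ0 : 0 < Λ := by rw [hΛ]; positivity
  have hc₂0 : 0 ≤ c₂ := by rw [hc₂]; positivity
  have hb0 : 0 ≤ b := by rw [hb]; positivity
  obtain ⟨A, hA⟩ : ∃ r : ℝ, r = Λ * σ₀ ^ 2 + 4 * (c₂ * η ^ 2) * C₃ := ⟨_, rfl⟩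
  have hA0 : 0 < A := by rw [hA]; positivity
  obtain ⟨a₁, ha₁⟩ : ∃ r : ℝ, r = g + 4 * (c₂ * η ^ 2) * M ^ 2 := ⟨_, rfl⟩
  obtain ⟨a₂, ha₂⟩ : ∃ r : ℝ, r = 4 * (c₂ * η ^ 2) / A + 2 * b := ⟨_, rfl⟩
  have ha₁0 : 0 ≤ a₁ := by rw [ha₁]; positivity
  have ha₂0 : 0 ≤ a₂ := by rw [ha₂]; positivity
  obtain ⟨C₅, hC₅⟩ : ∃ r : ℝ, r = 2 + 2 * C₃ * (a₁ + a₂) := ⟨_, rfl⟩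
  have hC₅0 : 0 ≤ C₅ := by rw [hC₅]; positivity
  refine ⟨4 / η * D + 4 * C₅ + 2 * C₁ ^ 2 + 2 * A * M' ^ 2 + 1, τmin * μ / 2, by positivity,
    by positivity, ?_⟩
  intro Ω _ P _ σ T K w τ τ' R hτ hτ' hw h0 h1 hT
  have hT0 : (0 : ℝ) < T := by exact_mod_cast hT
  have hT1 : (1 : ℝ) ≤ T := by exact_mod_cast hT
  have hpK : Real.exp (-(τmin * μ / 2 * K)) = ρ ^ K := by
    rw [hρ, ← Real.exp_nat_mul]
    congr 1
    ring
  rw [hpK]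
  set p := ρ ^ K with hp
  have hp0 : 0 < p := pow_pos (Real.exp_pos _) K
  have hmeas : ∀ t, Measurable fun ω => ‖gradient (hyperObjective J G) (R.φ t ω)‖ ^ 2 := fun t =>
    ((measurable_gradient _).comp (R.measurable_φ t)).norm.pow_const 2
  have hbound : ∀ t, MeanLE P
      (fun ω => ‖gradient (hyperObjective J G) (R.φ t ω)‖ ^ 2) (M' ^ 2) := fun t =>
    (MeanLE.const _).mono (hmeas t) (fun ω => sq_nonneg _)
      fun ω => pow_le_pow_left₀ (norm_nonneg _) (hM' _) 2
  refine ⟨fun t => (hbound t).1, ?_⟩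
  rw [← integral_finsetSum _ fun t _ => (hbound t).1]
  have hx1 : 0 ≤ 1 / (T : ℝ) := by positivity
  have hx2 : 0 ≤ p / σ ^ 2 := by positivity
  have hx3 : 0 ≤ w / σ ^ 2 := by positivity
  have hx4 : 0 ≤ σ ^ 2 := by positivity
  have hd1 : 0 ≤ 4 / η * D := by positivity
  -- Long inner loops allow the gap induction. In the other case `p/σ² > 1/(2A)`, so the uniform
  -- bound `M'²` is already of the order of the `e^{-cK}/σ²` term.
  by_cases hK : p * A ≤ σ ^ 2 / 2
  · obtain ⟨hdiff, hlip⟩ := hL σ h0 h1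
    have hgaps := R.meanLE_gaps hreg h0 h1 hτmin hτ hτ' hw hC₃ (hbias σ h0 h1)
      (M := M) (hreg.norm_gradient_proxyObjective_le h0 h1) (Λ := Λ) (c := c₂) (g := g) (b := b)
      (by rw [hΛ]; exact le_add_of_nonneg_right (by positivity))
      (by rw [hΛ]; exact le_add_of_nonneg_left (by positivity))
      (by rw [hc₂]; exact le_add_of_nonneg_right (by positivity))
      (by rw [hc₂]; exact le_add_of_nonneg_left (by positivity))
      hgJ (hgh σ h0.le h1) hρ
      (by rw [hb]; exact le_add_of_nonneg_right (by positivity))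
      (by rw [hb]; exact le_add_of_nonneg_left (by positivity)) hA hK
    rw [← hp, ← ha₁, ← ha₂] at hgaps
    have herr : ∀ t, MeanLE P (R.errSq t) (C₅ * (p / σ ^ 2 + w / σ ^ 2)) := fun t => by
      refine (R.meanLE_errSq hC₃ (hbias σ h0 h1) (hgaps t).1 (hgaps t).2).le ?_
      rw [← add_div, ← mul_div_assoc]
      refine div_le_div_of_nonneg_right ?_ hx4
      have e1 : 0 ≤ C₃ * a₂ * p := by positivity
      have e2 : 0 ≤ C₃ * a₁ * w := by positivity
      rw [hC₅]
      linarith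
    have hηL' : η * L ≤ 1 := by
      have h2 := mul_le_mul_of_nonneg_right hηL L.2
      have h3 : 1 / (2 * (L : ℝ)) * L ≤ 1 / 2 := by
        rw [one_div, mul_inv, mul_assoc, one_div]
        exact mul_le_of_le_one_right (by norm_num) inv_mul_le_one
      exact h2.trans (h3.trans (by norm_num))
    have htot := (((MeanLE.const (P := P) (2 / η * D)).add
      (MeanLE.sum (s := Finset.range (T + 1)) fun t _ => herr t)).const_mul zero_le_two).add
      (MeanLE.const (T * (2 * (C₁ * σ) ^ 2)))
    have hsum := htot.mono (X := fun ω => ∑ t ∈ Finset.Icc 1 T,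
        ‖gradient (hyperObjective J G) (R.φ t ω)‖ ^ 2)
      (Finset.measurable_fun_sum _ fun t _ => hmeas t)
      (fun ω => Finset.sum_nonneg fun t _ => sq_nonneg _) fun ω => by
        have e1 := R.sum_norm_gradient_sq_le hdiff hlip hη hηL' ω (T + 1)
        have e2 := hdec σ h0 h1 (R.φ (T + 1) ω)
        rw [R.φ_zero] at e1
        have e3 : 2 / η * (proxyObjective J G σ s₀.φ - proxyObjective J G σ (R.φ (T + 1) ω)) ≤
            2 / η * D := by gcongr
        have e4 : ∑ t ∈ Finset.Icc 1 T, ‖gradient (hyperObjective J G) (R.φ t ω)‖ ^ 2 ≤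
            ∑ t ∈ Finset.Icc 1 T,
              (2 * ‖gradient (proxyObjective J G σ) (R.φ t ω)‖ ^ 2 + 2 * (C₁ * σ) ^ 2) := by
          refine Finset.sum_le_sum fun t _ => ?_
          have f1 := sq_norm_le_two_mul (gradient (hyperObjective J G) (R.φ t ω))
            (gradient (proxyObjective J G σ) (R.φ t ω))
          have f2 := pow_le_pow_left₀ (norm_nonneg _) (happrox (R.φ t ω) σ h0 h1) 2
          rw [norm_sub_rev] at f2
          linarith
        -- The term `t = 0` is added because telescoping starts at the deterministic initial point.
        have e5 : ∑ t ∈ Finset.Icc 1 T, ‖gradient (proxyObjective J G σ) (R.φ t ω)‖ ^ 2 ≤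
            ∑ t ∈ Finset.range (T + 1), ‖gradient (proxyObjective J G σ) (R.φ t ω)‖ ^ 2 :=
          Finset.sum_le_sum_of_subset_of_nonneg
            (fun t ht => by rw [Finset.mem_Icc] at ht; rw [Finset.mem_range]; omega)
            fun t _ _ => sq_nonneg _
        rw [Finset.sum_add_distrib, ← Finset.mul_sum, Finset.sum_const, Nat.card_Icc,
          Nat.add_sub_cancel, nsmul_eq_mul] at e4
        linarith
    have hle := mul_le_mul_of_nonneg_left hsum.2 hx1
    refine hle.trans ?_
    rw [Finset.sum_const, Finset.card_range, nsmul_eq_mul]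
    have hr : 0 ≤ 2 * A * M' ^ 2 + 1 := by positivity
    exact (average_le (C₁ := C₁) hT hη hd1 (add_nonneg hx2 hx3) hC₅0 hx4 hr).trans_eq
      (by simp only [add_assoc])
  · have hsum := MeanLE.sum (s := Finset.Icc 1 T) fun t _ => hbound t
    refine (mul_le_mul_of_nonneg_left hsum.2 hx1).trans ?_
    rw [Finset.sum_const, Nat.card_Icc, Nat.add_sub_cancel, nsmul_eq_mul, ← mul_assoc,
      one_div_mul_cancel hT0.ne', one_mul]
    have e1 : 1 ≤ 2 * A * (p / σ ^ 2) := by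
      rw [← mul_div_assoc, le_div_iff₀ (by positivity)]
      linarith
    have e2 : M' ^ 2 ≤ 2 * A * M' ^ 2 * (p / σ ^ 2) := by nlinarith [sq_nonneg M']
    refine e2.trans (mul_le_mul ?_ ?_ hx2 ?_)
    · linarith [show 0 ≤ 2 * C₁ ^ 2 by positivity]
    · linarith
    · linarith [show 0 ≤ 2 * C₁ ^ 2 by positivity, show 0 ≤ 2 * A * M' ^ 2 by positivity]

end Regular

end Convergence

/-! ### The algorithm as an inexact run: adaptedness and sampling errors -/

section Algorithm

variable {m n : ℕ}

namespace SamplingModel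

variable {J G : Joint m n → ℝ} {sJ sG : ℝ} (S : SamplingModel J G sJ sG)
  (K B : ℕ) (σ η : ℝ) (τ τ' : ℕ → ℝ) (s₀ : State m n)

/-- The random state after `t` outer iterations. -/
def run (t : ℕ) (ω : S.Ω) : State m n :=
  state S.gJ S.gG K B σ η τ τ' s₀ (fun l => S.sample l ω) t

/-- The random inner iterate for `J`. -/
def iterY (t k : ℕ) (ω : S.Ω) : EuclideanSpace ℝ (Fin n) :=
  innerJ S.gJ B τ (S.run K B σ η τ τ' s₀ t ω).φ (S.run K B σ η τ τ' s₀ t ω).y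
    (fun k i j => S.sample (t, k, i, j) ω) k

/-- The random inner iterate for `h_σ`. -/
def iterY' (t k : ℕ) (ω : S.Ω) : EuclideanSpace ℝ (Fin n) :=
  innerPenalty S.gJ S.gG B σ τ' (S.run K B σ η τ τ' s₀ t ω).φ (S.run K B σ η τ τ' s₀ t ω).y'
    (fun k i j => S.sample (t, k, i, j) ω) k

theorem pastLabels_subset {t t' k k' : ℕ} (h : t < t' ∨ t = t' ∧ k ≤ k') :
    pastLabels t k ⊆ pastLabels t' k' := by
  rintro l (hl | ⟨hl, hl'⟩)
  · exact Or.inl (by omega)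
  · rcases h with h | ⟨h, h'⟩
    · exact Or.inl (by omega)
    · exact Or.inr ⟨by omega, by omega⟩

theorem measurable_minibatch_info {A : Set Label} {g : Joint m n → S.Ξ → Joint m n}
    (hg : Measurable fun p : Joint m n × S.Ξ => g p.1 p.2) (B : ℕ) {l : ℕ → Label}
    (hl : ∀ j, l j ∈ A) {φ : S.Ω → EuclideanSpace ℝ (Fin m)} {y : S.Ω → EuclideanSpace ℝ (Fin n)}
    (hφ : Measurable[S.info A] φ) (hy : Measurable[S.info A] y) :
    Measurable[S.info A]
      fun ω => minibatch g B (pt (φ ω) (y ω)) (fun j => S.sample (l j) ω) := by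
  have h1 : Measurable[S.info A] fun ω => pt (φ ω) (y ω) := measurable_pt.comp (hφ.prodMk hy)
  have h2 : Measurable[S.info A] fun ω j => S.sample (l j) ω :=
    @measurable_pi_lambda _ _ _ (S.info A) _ _ fun j => S.measurable_sample_info (hl j)
  exact (measurable_minibatch hg B).comp (h1.prodMk h2)

/-- Adaptedness: iterate `k` uses only samples of earlier inner steps, which is what makes the
minibatch at `(t, k)` independent of it. -/
theorem measurable_innerJ {φ : S.Ω → EuclideanSpace ℝ (Fin m)} {y : S.Ω → EuclideanSpace ℝ (Fin n)}
    {t : ℕ} (hφ : Measurable[S.info (pastLabels t 0)] φ)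
    (hy : Measurable[S.info (pastLabels t 0)] y) (k : ℕ) :
    Measurable[S.info (pastLabels t k)] fun ω =>
      innerJ S.gJ B τ (φ ω) (y ω) (fun k i j => S.sample (t, k, i, j) ω) k := by
  have hmono : ∀ k, S.info (pastLabels t k) ≤ S.info (pastLabels t (k + 1)) := fun k =>
    S.info_mono (pastLabels_subset (by omega))
  have hmono0 : ∀ k, S.info (pastLabels t 0) ≤ S.info (pastLabels t k) := fun k =>
    S.info_mono (pastLabels_subset (by omega))
  induction k with
  | zero => exact hy
  | succ k ih =>
    have ih' := ih.mono (hmono k) le_rfl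
    refine ih'.add (Measurable.const_smul (measurable_lower.comp ?_) (τ k))
    exact S.measurable_minibatch_info S.stochGradient_J.measurable B
      (fun j => Or.inr ⟨rfl, Nat.lt_succ_self k⟩) (hφ.mono (hmono0 _) le_rfl) ih'

theorem measurable_innerPenalty {φ : S.Ω → EuclideanSpace ℝ (Fin m)}
    {y : S.Ω → EuclideanSpace ℝ (Fin n)} {t : ℕ} (hφ : Measurable[S.info (pastLabels t 0)] φ)
    (hy : Measurable[S.info (pastLabels t 0)] y) (k : ℕ) :
    Measurable[S.info (pastLabels t k)] fun ω =>
      innerPenalty S.gJ S.gG B σ τ' (φ ω) (y ω) (fun k i j => S.sample (t, k, i, j) ω) k := by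
  have hmono : ∀ k, S.info (pastLabels t k) ≤ S.info (pastLabels t (k + 1)) := fun k =>
    S.info_mono (pastLabels_subset (by omega))
  have hmono0 : ∀ k, S.info (pastLabels t 0) ≤ S.info (pastLabels t k) := fun k =>
    S.info_mono (pastLabels_subset (by omega))
  induction k with
  | zero => exact hy
  | succ k ih =>
    have ih' := ih.mono (hmono k) le_rfl
    refine ih'.add (Measurable.const_smul (Measurable.sub (measurable_lower.comp ?_)
      (Measurable.const_smul (measurable_lower.comp ?_) σ)) (τ' k))
    · exact S.measurable_minibatch_info S.stochGradient_J.measurable B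
        (fun j => Or.inr ⟨rfl, Nat.lt_succ_self k⟩) (hφ.mono (hmono0 _) le_rfl) ih'
    · exact S.measurable_minibatch_info S.stochGradient_G.measurable B
        (fun j => Or.inr ⟨rfl, Nat.lt_succ_self k⟩) (hφ.mono (hmono0 _) le_rfl) ih'

theorem measurable_hyperEstimate {A : Set Label} {t k : ℕ} (hA : ∀ i j, (t, k, i, j) ∈ A)
    {φ : S.Ω → EuclideanSpace ℝ (Fin m)} {y y' : S.Ω → EuclideanSpace ℝ (Fin n)}
    (hφ : Measurable[S.info A] φ) (hy : Measurable[S.info A] y) (hy' : Measurable[S.info A] y') :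
    Measurable[S.info A] fun ω => hyperEstimate S.gJ S.gG B σ (φ ω) (y ω) (y' ω)
      (fun i j => S.sample (t, k, i, j) ω) := by
  have hJ := S.stochGradient_J.measurable
  have hG := S.stochGradient_G.measurable
  exact (measurable_upper.comp (S.measurable_minibatch_info hG B (hA 2) hφ hy')).add
    (((measurable_upper.comp (S.measurable_minibatch_info hJ B (hA 0) hφ hy)).sub
      (measurable_upper.comp (S.measurable_minibatch_info hJ B (hA 1) hφ hy'))).const_smul (1 / σ))

theorem measurable_run (t : ℕ) :
    Measurable[S.info (pastLabels t 0)] (fun ω => (S.run K B σ η τ τ' s₀ t ω).φ) ∧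
    Measurable[S.info (pastLabels t 0)] (fun ω => (S.run K B σ η τ τ' s₀ t ω).y) ∧
    Measurable[S.info (pastLabels t 0)] (fun ω => (S.run K B σ η τ τ' s₀ t ω).y') := by
  induction t with
  | zero =>
    have h : ∀ {d : ℕ} (c : EuclideanSpace ℝ (Fin d)),
        Measurable[S.info (pastLabels 0 0)] fun _ : S.Ω => c := fun c =>
      @measurable_const _ _ _ (S.info _) c
    exact ⟨h s₀.φ, h s₀.y, h s₀.y'⟩
  | succ t ih =>
    obtain ⟨h1, h2, h3⟩ := ih
    have hmono : ∀ k, S.info (pastLabels t k) ≤ S.info (pastLabels (t + 1) 0) := fun k =>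
      S.info_mono (pastLabels_subset (by omega))
    have h1' := h1.mono (hmono 0) le_rfl
    have h2' := (S.measurable_innerJ B τ h1 h2 K).mono (hmono K) le_rfl
    have h3' := (S.measurable_innerPenalty B σ τ' h1 h3 K).mono (hmono K) le_rfl
    exact ⟨h1'.sub ((S.measurable_hyperEstimate B σ (fun i j => Or.inl (Nat.lt_succ_self t))
      h1' h2' h3').const_smul η), h2', h3'⟩

theorem measurable_iterY (t k : ℕ) :
    Measurable[S.info (pastLabels t k)] (S.iterY K B σ η τ τ' s₀ t k) :=
  S.measurable_innerJ B τ (S.measurable_run K B σ η τ τ' s₀ t).1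
    (S.measurable_run K B σ η τ τ' s₀ t).2.1 k

theorem measurable_iterY' (t k : ℕ) :
    Measurable[S.info (pastLabels t k)] (S.iterY' K B σ η τ τ' s₀ t k) :=
  S.measurable_innerPenalty B σ τ' (S.measurable_run K B σ η τ τ' s₀ t).1
    (S.measurable_run K B σ η τ τ' s₀ t).2.2 k

theorem measurable_pt_iterY (t k : ℕ) :
    Measurable[S.info (pastLabels t k)] fun ω =>
      pt (S.run K B σ η τ τ' s₀ t ω).φ (S.iterY K B σ η τ τ' s₀ t k ω) :=
  measurable_pt.comp (((S.measurable_run K B σ η τ τ' s₀ t).1.mono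
    (S.info_mono (pastLabels_subset (by omega))) le_rfl).prodMk
    (S.measurable_iterY K B σ η τ τ' s₀ t k))

theorem measurable_pt_iterY' (t k : ℕ) :
    Measurable[S.info (pastLabels t k)] fun ω =>
      pt (S.run K B σ η τ τ' s₀ t ω).φ (S.iterY' K B σ η τ τ' s₀ t k ω) :=
  measurable_pt.comp (((S.measurable_run K B σ η τ τ' s₀ t).1.mono
    (S.info_mono (pastLabels_subset (by omega))) le_rfl).prodMk
    (S.measurable_iterY' K B σ η τ τ' s₀ t k))

/-- A minibatch gradient at a random point. -/
def batch (g : Joint m n → S.Ξ → Joint m n) (t k : ℕ) (i : Fin 3) (z : S.Ω → Joint m n)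
    (ω : S.Ω) : Joint m n :=
  minibatch g B (z ω) (fun j => S.sample (t, k, i, j) ω)

theorem measurable_batch {g : Joint m n → S.Ξ → Joint m n}
    (hg : Measurable fun p : Joint m n × S.Ξ => g p.1 p.2) (t k : ℕ) (i : Fin 3)
    {z : S.Ω → Joint m n} (hz : Measurable z) : Measurable (S.batch B g t k i z) :=
  (measurable_minibatch hg B).comp (hz.prodMk (measurable_pi_lambda _ fun j =>
    S.measurable_sample (t, k, i, j)))

/-- The mean squared error of the direction of the inner loop for `J`. -/
theorem meanLE_errJ {B : ℕ} (hB : 1 ≤ B) (t k : ℕ) {z : S.Ω → Joint m n}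
    (hz : Measurable[S.info (pastLabels t k)] z) (σ₀ : ℝ) :
    MeanLE S.P (fun ω => ‖lower (S.batch B S.gJ t k 0 z ω) - lower (gradient J (z ω))‖ ^ 2)
      ((6 * sJ ^ 2 + 3 * σ₀ ^ 2 * sG ^ 2) / B) := by
  have hz' : Measurable z := hz.mono (S.info_le _) le_rfl
  have hm : Measurable fun ω =>
      ‖lower (S.batch B S.gJ t k 0 z ω) - lower (gradient J (z ω))‖ ^ 2 :=
    ((measurable_lower.comp (S.measurable_batch B S.stochGradient_J.measurable t k 0 hz')).sub
      (measurable_lower.comp ((measurable_gradient J).comp hz'))).norm.pow_const 2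
  have h := S.meanLE_minibatch S.stochGradient_J hB 0 hz
  refine (h.mono hm (fun ω => sq_nonneg _) fun ω => ?_).le ?_
  · rw [← lower_sub]
    exact pow_le_pow_left₀ (norm_nonneg _) (norm_lower_le _) 2
  · refine div_le_div_of_nonneg_right ?_ (Nat.cast_nonneg B)
    nlinarith [sq_nonneg sJ, mul_nonneg (sq_nonneg σ₀) (sq_nonneg sG)]

section Errors

variable {σ₀ μ : ℝ} {LJ Lh LH LG : ℝ≥0} (hreg : Regular J G σ₀ μ LJ Lh LH LG)
include hreg

/-- The mean squared error of the direction of the inner loop for `h_σ`. -/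
theorem meanLE_errPenalty (hσ : 0 ≤ σ) (hσ₀ : σ ≤ σ₀) {B : ℕ} (hB : 1 ≤ B) (t k : ℕ)
    {z : S.Ω → Joint m n} (hz : Measurable[S.info (pastLabels t k)] z) :
    MeanLE S.P (fun ω => ‖lower (S.batch B S.gJ t k 1 z ω) - σ • lower (S.batch B S.gG t k 2 z ω) -
      lower (gradient (penalty J G σ) (z ω))‖ ^ 2) ((6 * sJ ^ 2 + 3 * σ₀ ^ 2 * sG ^ 2) / B) := by
  have hz' : Measurable z := hz.mono (S.info_le _) le_rfl
  have hm := ((measurable_lower.comp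
    (S.measurable_batch B S.stochGradient_J.measurable t k 1 hz')).sub ((measurable_lower.comp
    (S.measurable_batch B S.stochGradient_G.measurable t k 2 hz')).const_smul σ)).sub
    (measurable_lower.comp ((measurable_gradient (penalty J G σ)).comp hz'))
  refine ((((S.meanLE_minibatch S.stochGradient_J hB 1 hz).const_mul zero_le_two).add
    ((S.meanLE_minibatch S.stochGradient_G hB 2 hz).const_mul (c := 2 * σ ^ 2)
      (by positivity))).mono (hm.norm.pow_const 2) (fun ω => sq_nonneg _) fun ω => ?_).le ?_
  · set a := S.batch B S.gJ t k 1 z ω with ha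
    set b := S.batch B S.gG t k 2 z ω with hb
    have h := sq_norm_le_two_mul (lower a - σ • lower b - lower (gradient (penalty J G σ) (z ω)))
      (-(σ • lower (b - gradient G (z ω))))
    have e : lower a - σ • lower b - lower (gradient (penalty J G σ) (z ω)) -
        -(σ • lower (b - gradient G (z ω))) = lower (a - gradient J (z ω)) := by
      rw [hreg.gradient_penalty]
      simp only [lower_sub, lower_smul]
      -- Uses `∇h_σ = ∇J - σ∇G`. The triangle inequality handles the two minibatch errors, so their
      -- mutual independence plays no role.
      module
    rw [e, norm_neg, norm_smul, mul_pow, Real.norm_eq_abs, sq_abs] at h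
    have h1 := pow_le_pow_left₀ (norm_nonneg _) (norm_lower_le (a - gradient J (z ω))) 2
    have h2 := mul_le_mul_of_nonneg_left (pow_le_pow_left₀ (norm_nonneg _)
      (norm_lower_le (b - gradient G (z ω))) 2) (sq_nonneg σ)
    change ‖lower a - σ • lower b - lower (gradient (penalty J G σ) (z ω))‖ ^ 2 ≤
      2 * ‖a - gradient J (z ω)‖ ^ 2 + 2 * σ ^ 2 * ‖b - gradient G (z ω)‖ ^ 2
    linarith
  · rw [← mul_div_assoc, ← mul_div_assoc, ← add_div]
    refine div_le_div_of_nonneg_right ?_ (Nat.cast_nonneg B)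
    have := mul_le_mul_of_nonneg_right (pow_le_pow_left₀ hσ hσ₀ 2) (sq_nonneg sG)
    nlinarith [sq_nonneg sJ, mul_nonneg (sq_nonneg σ₀) (sq_nonneg sG)]

/-- The mean squared error of the hypergradient estimate. -/
theorem meanLE_errHyper (hσ : 0 < σ) (hσ₀ : σ ≤ σ₀) {B : ℕ} (hB : 1 ≤ B) (t k : ℕ)
    {z z' : S.Ω → Joint m n} (hz : Measurable[S.info (pastLabels t k)] z)
    (hz' : Measurable[S.info (pastLabels t k)] z') :
    MeanLE S.P (fun ω => ‖upper (S.batch B S.gG t k 2 z' ω) + (1 / σ) •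
        (upper (S.batch B S.gJ t k 0 z ω) - upper (S.batch B S.gJ t k 1 z' ω)) -
        (1 / σ) • (upper (gradient J (z ω)) - upper (gradient (penalty J G σ) (z' ω)))‖ ^ 2)
      ((6 * sJ ^ 2 + 3 * σ₀ ^ 2 * sG ^ 2) / B / σ ^ 2) := by
  have hzm : Measurable z := hz.mono (S.info_le _) le_rfl
  have hzm' : Measurable z' := hz'.mono (S.info_le _) le_rfl
  have hJm := S.stochGradient_J.measurable
  have hm := ((measurable_upper.comp (S.measurable_batch B S.stochGradient_G.measurable t k 2 hzm')).add
    (((measurable_upper.comp (S.measurable_batch B hJm t k 0 hzm)).sub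
      (measurable_upper.comp (S.measurable_batch B hJm t k 1 hzm'))).const_smul (1 / σ))).sub
    (((measurable_upper.comp ((measurable_gradient J).comp hzm)).sub
      (measurable_upper.comp ((measurable_gradient (penalty J G σ)).comp hzm'))).const_smul (1 / σ))
  refine ((((S.meanLE_minibatch S.stochGradient_G hB 2 hz').const_mul zero_le_three).add
    (((S.meanLE_minibatch S.stochGradient_J hB 0 hz).add
      (S.meanLE_minibatch S.stochGradient_J hB 1 hz')).const_mul (c := 3 / σ ^ 2)
      (by positivity))).mono (hm.norm.pow_const 2) (fun ω => sq_nonneg _) fun ω => ?_).le ?_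
  · set c := S.batch B S.gG t k 2 z' ω with hc
    set a := S.batch B S.gJ t k 0 z ω with ha
    set b := S.batch B S.gJ t k 1 z' ω with hb
    have e : upper c + (1 / σ) • (upper a - upper b) -
        (1 / σ) • (upper (gradient J (z ω)) - upper (gradient (penalty J G σ) (z' ω))) =
        upper (c - gradient G (z' ω)) + ((1 / σ) • upper (a - gradient J (z ω)) -
          (1 / σ) • upper (b - gradient J (z' ω))) := by
      rw [hreg.gradient_penalty]
      simp only [upper_sub, upper_smul]
      have hσ' : σ ≠ 0 := hσ.ne'
      match_scalars <;> field_simp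
    change ‖upper c + (1 / σ) • (upper a - upper b) -
        (1 / σ) • (upper (gradient J (z ω)) - upper (gradient (penalty J G σ) (z' ω)))‖ ^ 2 ≤
      3 * ‖c - gradient G (z' ω)‖ ^ 2 +
        3 / σ ^ 2 * (‖a - gradient J (z ω)‖ ^ 2 + ‖b - gradient J (z' ω)‖ ^ 2)
    rw [e]
    have h1 := norm_upper_le (c - gradient G (z' ω))
    have h2 := norm_upper_le (a - gradient J (z ω))
    have h3 := norm_upper_le (b - gradient J (z' ω))
    set C := ‖c - gradient G (z' ω)‖
    set A := ‖a - gradient J (z ω)‖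
    set D := ‖b - gradient J (z' ω)‖
    have hσ1 : (0 : ℝ) ≤ 1 / σ := by positivity
    have h4 : ‖upper (c - gradient G (z' ω)) + ((1 / σ) • upper (a - gradient J (z ω)) -
        (1 / σ) • upper (b - gradient J (z' ω)))‖ ≤ C + (1 / σ * A + 1 / σ * D) := by
      refine (norm_add_le _ _).trans (add_le_add h1 ((norm_sub_le _ _).trans ?_))
      rw [norm_smul, norm_smul, Real.norm_of_nonneg hσ1]
      gcongr
    have h5 : 3 / σ ^ 2 * (A ^ 2 + D ^ 2) = 3 * ((1 / σ * A) ^ 2 + (1 / σ * D) ^ 2) := by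
      field_simp
    rw [h5]
    refine (pow_le_pow_left₀ (norm_nonneg _) h4 2).trans ?_
    nlinarith [sq_nonneg (C - 1 / σ * A), sq_nonneg (C - 1 / σ * D),
      sq_nonneg (1 / σ * A - 1 / σ * D)]
  · have hB0 : (0 : ℝ) < B := by exact_mod_cast hB
    have h2 := mul_le_mul_of_nonneg_right (pow_le_pow_left₀ hσ.le hσ₀ 2) (sq_nonneg sG)
    -- This estimate dictates the common variance constant `6 sJ² + 3 σ₀² sG²`; the inner-loop
    -- errors are weakened to the same value.
    have e : 3 * (sG ^ 2 / B) + 3 / σ ^ 2 * (sJ ^ 2 / B + sJ ^ 2 / B) =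
        (6 * sJ ^ 2 + 3 * (σ ^ 2 * sG ^ 2)) / B / σ ^ 2 := by
      field_simp
      ring
    rw [e]
    exact div_le_div_of_nonneg_right (div_le_div_of_nonneg_right (by linarith) hB0.le)
      (sq_nonneg σ)

end Errors

/-- The bilevel algorithm is a run with inexact gradients. -/
def inexactRun {σ₀ μ : ℝ} {LJ Lh LH LG : ℝ≥0} (hreg : Regular J G σ₀ μ LJ Lh LH LG)
    (hσ : 0 < σ) (hσ₀ : σ ≤ σ₀) (hB : 1 ≤ B) :
    InexactRun J G S.P K σ η ((6 * sJ ^ 2 + 3 * σ₀ ^ 2 * sG ^ 2) / B) τ τ' s₀ where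
  φ t ω := (S.run K B σ η τ τ' s₀ t ω).φ
  y := S.iterY K B σ η τ τ' s₀
  y' := S.iterY' K B σ η τ τ' s₀
  d t k ω := lower (S.batch B S.gJ t k 0 (fun ω =>
    pt (S.run K B σ η τ τ' s₀ t ω).φ (S.iterY K B σ η τ τ' s₀ t k ω)) ω)
  d' t k ω := lower (S.batch B S.gJ t k 1 (fun ω =>
      pt (S.run K B σ η τ τ' s₀ t ω).φ (S.iterY' K B σ η τ τ' s₀ t k ω)) ω) -
    σ • lower (S.batch B S.gG t k 2 (fun ω =>
      pt (S.run K B σ η τ τ' s₀ t ω).φ (S.iterY' K B σ η τ τ' s₀ t k ω)) ω)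
  e t ω := hyperEstimate S.gJ S.gG B σ (S.run K B σ η τ τ' s₀ t ω).φ
    (S.iterY K B σ η τ τ' s₀ t K ω) (S.iterY' K B σ η τ τ' s₀ t K ω)
    (fun i j => S.sample (t, K, i, j) ω)
  measurable_φ t := (S.measurable_run K B σ η τ τ' s₀ t).1.mono (S.info_le _) le_rfl
  measurable_y t k := (S.measurable_iterY K B σ η τ τ' s₀ t k).mono (S.info_le _) le_rfl
  measurable_y' t k := (S.measurable_iterY' K B σ η τ τ' s₀ t k).mono (S.info_le _) le_rfl
  measurable_e t := by
    have hle : ∀ A, S.info A ≤ S.info Set.univ := fun A => S.info_mono (Set.subset_univ A)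
    exact (S.measurable_hyperEstimate B σ (A := Set.univ) (fun _ _ => trivial)
      ((S.measurable_run K B σ η τ τ' s₀ t).1.mono (hle _) le_rfl)
      ((S.measurable_iterY K B σ η τ τ' s₀ t K).mono (hle _) le_rfl)
      ((S.measurable_iterY' K B σ η τ τ' s₀ t K).mono (hle _) le_rfl)).mono (S.info_le _) le_rfl
  φ_zero _ := rfl
  y_zero _ := rfl
  y'_zero _ := rfl
  φ_step _ _ := rfl
  y_step _ _ _ := rfl
  y'_step _ _ _ := rfl
  y_next _ _ := rfl
  y'_next _ _ := rfl
  d_err t k := S.meanLE_errJ hB t k (S.measurable_pt_iterY K B σ η τ τ' s₀ t k) σ₀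
  d'_err t k := S.meanLE_errPenalty σ hreg hσ.le hσ₀ hB t k
    (S.measurable_pt_iterY' K B σ η τ τ' s₀ t k)
  e_err t := S.meanLE_errHyper σ hreg hσ hσ₀ hB t K (S.measurable_pt_iterY K B σ η τ τ' s₀ t K)
    (S.measurable_pt_iterY' K B σ η τ τ' s₀ t K)

end SamplingModel

end Algorithm

/-! ### Parameter choice and sample count -/

section Complexity

/-- A ceiling at most doubles a number that is at least 1, which handles `T` and `B`. The logarithm
may vanish, so `K` gets an additive bound instead. -/
theorem sample_complexity_le {a ε : ℝ} (ha : 0 < a) (hε : 0 < ε) (hε1 : ε ≤ 1) {T K B : ℕ}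
    (hT : T = ⌈1 / ε⌉₊) (hB : B = ⌈1 / ε ^ 2⌉₊) (hK : K = ⌈a * Real.log (1 / ε)⌉₊) :
    ((drawnSamples T K B).card : ℝ) ≤
      (12 * a + 24) * (1 / ε ^ 3) * (1 + Real.log (1 / ε)) := by
  have hlog : 0 ≤ Real.log (1 / ε) := Real.log_nonneg (by rw [le_div_iff₀ hε]; linarith)
  have e1 : (1 : ℝ) ≤ 1 / ε := by rw [le_div_iff₀ hε]; linarith
  have e2 : (1 : ℝ) ≤ 1 / ε ^ 2 := by
    rw [le_div_iff₀ (by positivity), one_mul]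
    exact pow_le_one₀ hε.le hε1
  have hT' : (T : ℝ) ≤ 2 * (1 / ε) := by
    have := Nat.ceil_lt_add_one (zero_le_one.trans e1)
    rw [← hT] at this
    linarith
  have hB' : (B : ℝ) ≤ 2 * (1 / ε ^ 2) := by
    have := Nat.ceil_lt_add_one (zero_le_one.trans e2)
    rw [← hB] at this
    linarith
  have hK' : (K : ℝ) + 1 ≤ a * Real.log (1 / ε) + 2 := by
    have := Nat.ceil_lt_add_one (mul_nonneg ha.le hlog)
    rw [← hK] at this
    linarith
  rw [card_drawnSamples]
  push_cast
  calc (3 * (B * K * T + B * T) : ℝ) = 3 * (B * T * (K + 1)) := by ring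
    _ ≤ 3 * (2 * (1 / ε ^ 2) * (2 * (1 / ε)) * (a * Real.log (1 / ε) + 2)) := by gcongr
    _ = 1 / ε ^ 3 * (12 * a * Real.log (1 / ε) + 24) := by
      field_simp
      ring
    _ ≤ 1 / ε ^ 3 * ((12 * a + 24) * (1 + Real.log (1 / ε))) := by
      gcongr
      linarith
    _ = _ := by ring

/-- Each of the four terms is at most `ε`; `a = 2/c` gives `e^{-cK} ≤ ε²`, one power of which pays
for `1/σ² = 1/ε`. -/
theorem rate_le {a c ε : ℝ} (hc : 0 < c) (ha : a = 2 / c) (hε : 0 < ε) {T K B : ℕ}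
    (hT : T = ⌈1 / ε⌉₊) (hB : B = ⌈1 / ε ^ 2⌉₊) (hK : K = ⌈a * Real.log (1 / ε)⌉₊) :
    1 / (T : ℝ) + Real.exp (-(c * K)) / ε + 1 / (ε * B) + ε ≤ 4 * ε := by
  have hT' : 1 / ε ≤ T := hT ▸ Nat.le_ceil _
  have hB' : 1 / ε ^ 2 ≤ B := hB ▸ Nat.le_ceil _
  have hK' : a * Real.log (1 / ε) ≤ K := hK ▸ Nat.le_ceil _
  have e1 : 1 / (T : ℝ) ≤ ε := (one_div_le (lt_of_lt_of_le (by positivity) hT') hε).2 hT'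
  have e2 : Real.exp (-(c * K)) / ε ≤ ε := by
    rw [div_le_iff₀ hε, ← Real.log_le_log_iff (Real.exp_pos _) (by positivity), Real.log_exp,
      Real.log_mul hε.ne' hε.ne']
    rw [one_div, Real.log_inv] at hK'
    have := mul_le_mul_of_nonneg_left hK' hc.le
    have h2 : c * (a * -Real.log ε) = -(2 * Real.log ε) := by
      rw [ha]
      field_simp
    linarith
  have e3 : 1 / (ε * B) ≤ ε := by
    have hB0 : (0 : ℝ) < B := lt_of_lt_of_le (by positivity) hB'
    rw [div_le_iff₀ (by positivity)]
    rw [div_le_iff₀ (by positivity)] at hB'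
    linarith
  linarith

end Complexity

end Bilevel

end

/-! ### The main theorem -/

theorem theorem2 {m n : ℕ} (J G : Bilevel.Joint m n → ℝ) (σ₀ μ : ℝ)
    (LJ Lh LH LG : ℝ≥0) (hreg : Bilevel.Regular J G σ₀ μ LJ Lh LH LG)
    (hbdd : BddBelow (Set.range (Bilevel.hyperObjective J G)))
    (sJ sG : ℝ) (s₀ : Bilevel.State m n) :
    Differentiable ℝ (Bilevel.hyperObjective J G) ∧
    (∃ L : ℝ≥0, Bilevel.ProxySmooth J G σ₀ L) ∧
    ∀ L : ℝ≥0, Bilevel.ProxySmooth J G σ₀ L →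
    ∀ η : ℝ, 0 < η → η ≤ 1 / (2 * (L : ℝ)) →
    ∀ τmin : ℝ, 0 < τmin →
    ∃ C c a : ℝ, 0 < C ∧ 0 < c ∧ 0 < a ∧
    ∀ (S : Bilevel.SamplingModel.{u, v} J G sJ sG) (τ τ' : ℕ → ℝ),
      (∀ k, τmin ≤ τ k ∧ τ k ≤ 1 / (LJ : ℝ)) →
      (∀ k, τmin ≤ τ' k ∧ τ' k ≤ 1 / (Lh : ℝ)) →
      (∀ (σ : ℝ) (T K B : ℕ), 0 < σ → σ ≤ σ₀ → 1 ≤ T → 1 ≤ B →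
        (∀ t, Integrable (fun ω => ‖gradient (Bilevel.hyperObjective J G)
          (S.iterate K B σ η τ τ' s₀ t ω)‖ ^ 2) S.P) ∧
        S.avgSqGrad T K B σ η τ τ' s₀ ≤
          C * (1 / (T : ℝ) + Real.exp (-(c * (K : ℝ))) / σ ^ 2
            + 1 / (σ ^ 2 * (B : ℝ)) + σ ^ 2)) ∧
      (∀ (ε : ℝ) (T K B : ℕ), 0 < ε → ε ≤ 1 → ε ≤ σ₀ ^ 2 →
        T = ⌈1 / ε⌉₊ → B = ⌈1 / ε ^ 2⌉₊ → K = ⌈a * Real.log (1 / ε)⌉₊ →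
        S.avgSqGrad T K B (Real.sqrt ε) η τ τ' s₀ ≤ C * ε ∧
        ((Bilevel.drawnSamples T K B).card : ℝ) ≤ C * (1 / ε ^ 3) * (1 + Real.log (1 / ε))) := by
  refine ⟨hreg.differentiable_hyperObjective, hreg.exists_proxySmooth, ?_⟩
  intro L hL η hη hηL τmin hτmin
  obtain ⟨C, c, hC, hc, h⟩ := hreg.exists_avg_bound hbdd s₀ hL hη hηL hτmin
  obtain ⟨V, hV⟩ : ∃ V : ℝ, V = 6 * sJ ^ 2 + 3 * σ₀ ^ 2 * sG ^ 2 := ⟨_, rfl⟩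
  have hV0 : 0 ≤ V := by rw [hV]; positivity
  have ha : 0 < 2 / c := by positivity
  have hCV : 0 < C * (1 + V) := by positivity
  -- One constant for all claims: `C(1+V)` absorbs the variance, the factor 4 counts the terms in
  -- `rate_le`, and the last summand is the constant of the sample count.
  refine ⟨4 * (C * (1 + V)) + (12 * (2 / c) + 24), c, 2 / c, by positivity, hc, ha, ?_⟩
  intro S τ τ' hτ hτ'
  have hbound : ∀ (σ : ℝ) (T K B : ℕ), 0 < σ → σ ≤ σ₀ → 1 ≤ T → 1 ≤ B →
      (∀ t, Integrable (fun ω => ‖gradient (Bilevel.hyperObjective J G)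
        (S.iterate K B σ η τ τ' s₀ t ω)‖ ^ 2) S.P) ∧
      S.avgSqGrad T K B σ η τ τ' s₀ ≤ C * (1 + V) *
        (1 / (T : ℝ) + Real.exp (-(c * (K : ℝ))) / σ ^ 2 + 1 / (σ ^ 2 * (B : ℝ)) + σ ^ 2) := by
    intro σ T K B hσ hσ₀ hT hB
    have hB0 : (0 : ℝ) < B := by exact_mod_cast hB
    obtain ⟨h1, h2⟩ := h S.P σ T K (V / B) τ τ'
      (hV ▸ S.inexactRun K B σ η τ τ' s₀ hreg hσ hσ₀ hB) hτ hτ' (by positivity) hσ hσ₀ hT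
    subst hV
    refine ⟨h1, le_trans h2 ?_⟩
    set V := 6 * sJ ^ 2 + 3 * σ₀ ^ 2 * sG ^ 2
    have e1 : V / B / σ ^ 2 = V * (1 / (σ ^ 2 * B)) := by field_simp
    rw [e1, mul_assoc]
    have x1 : 0 ≤ 1 / (T : ℝ) := by positivity
    have x2 : 0 ≤ Real.exp (-(c * (K : ℝ))) / σ ^ 2 := by positivity
    have x3 : 0 ≤ 1 / (σ ^ 2 * (B : ℝ)) := by positivity
    refine mul_le_mul_of_nonneg_left ?_ hC.le
    nlinarith [mul_nonneg hV0 x1, mul_nonneg hV0 x2, mul_nonneg hV0 (sq_nonneg σ)]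
  refine ⟨fun σ T K B hσ hσ₀ hT hB => ⟨(hbound σ T K B hσ hσ₀ hT hB).1,
    (hbound σ T K B hσ hσ₀ hT hB).2.trans (mul_le_mul_of_nonneg_right (by linarith) ?_)⟩, ?_⟩
  · positivity
  · intro ε T K B hε hε1 hεσ hT hB hK
    have hσ : 0 < Real.sqrt ε := Real.sqrt_pos.2 hε
    have hσ₀ : Real.sqrt ε ≤ σ₀ := Real.sqrt_le_iff.2 ⟨hreg.sigma_pos.le, hεσ⟩
    have hT1 : 1 ≤ T := by rw [hT]; exact Nat.one_le_ceil_iff.2 (by positivity)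
    have hB1 : 1 ≤ B := by rw [hB]; exact Nat.one_le_ceil_iff.2 (by positivity)
    constructor
    · have h1 := (hbound (Real.sqrt ε) T K B hσ hσ₀ hT1 hB1).2
      rw [Real.sq_sqrt hε.le] at h1
      have h2 := Bilevel.rate_le hc rfl hε hT hB hK
      have h3 := mul_le_mul_of_nonneg_left h2 hCV.le
      have h4 : 0 ≤ (12 * (2 / c) + 24) * ε := by positivity
      linarith
    · refine (Bilevel.sample_complexity_le ha hε hε1 hT hB hK).trans ?_
      have hlog : 0 ≤ Real.log (1 / ε) := Real.log_nonneg (by rw [le_div_iff₀ hε]; linarith)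
      exact mul_le_mul_of_nonneg_right (mul_le_mul_of_nonneg_right (by linarith) (by positivity))
        (by linarith)
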